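/- **Setting.** Let $G=(V,E)$ be an unweighted directed graph with $n=|V|$ vertices whose underlying undirected graph is connected, with (unweighted, undirected) diameter $D$. Let $P=(s=v_0,v_1,\dots,v_h=t)$ be a given shortest path from $s$ to $t$ in $G$. For an edge $e$ of $P$, $|st\diamond e|$ is the length of a shortest $s$–$t$ path in $G$ avoiding $e$. A *replacement path* for $e=(v_i,v_{i+1})$ with *detour* $Q$ is the concatenation of the subpath $(v_0,\dots,v_j)$ of $P$, a path $Q$ from $v_j$ to $v_l$ in $G$ that shares no edge with $P$, and the subpath $(v_l,\dots,v_h)$ of $P$, where $j\le i$ and $l\ge i+1$. The detour is *long* if it has more than $n^{2/3}$ edges. A minimum over the empty set is $\infty$. **Model (CONGEST).** The communication network is the underlying undirected graph of $G$, where every vertex has a unique $O(\log n)$-bit identifier. Computation proceeds in synchronous rounds; in each round every vertex can send a (possibly distinct) message of $O(\log n)$ bits to each of its neighbors; local computation is unlimited, and each vertex has private random bits. Initially a vertex knows $n$, its own identifier, the identifiers of its neighbors with the directions of its incident edges, which of its incident edges belong to $P$, and whether it is $s$ or $t$. An algorithm takes $T$ rounds if every vertex has halted with its output after at most $T$ rounds.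 $\widetilde O(\cdot)$ suppresses factors polylogarithmic in $n$. **Proposition.** For unweighted directed graphs, for every constant $a$, there is a randomized CONGEST algorithm that always takes $\widetilde O(n^{2/3}+D)$ rounds and such that, with probability at least $1-n^{-a}$, for every edge $e=(v_i,v_{i+1})$ of $P$ simultaneously, the first endpoint $v_i$ outputs a number $x\in\mathbb N\cup\{\infty\}$ with $$|st\diamond e|\;\le\; x\;\le\;\text{the length of a shortest replacement path for } e \text{ with a long detour}.$$ -/

import Mathlib

/-! ## Directed graphs, paths and distances -/

/-- A (simple) directed path of `H` from `u` to `v`, as the list of the vertices it visits. -/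
structure IsDiPath {V : Type} (H : Digraph V) (u v : V) (l : List V) : Prop where
  chain : l.IsChain H.Adj
  nodup : l.Nodup
  head : l.head? = some u
  last : l.getLast? = some v

/-- The length (number of edges) of the path or walk that visits the vertices of `l` in order. -/
def pathLength {V : Type} (l : List V) : ℕ := l.length - 1

/-- The length of a shortest path of `H` from `u` to `v`; it is `⊤` if there is no such path. -/
noncomputable def diDist {V : Type} (H : Digraph V) (u v : V) : ℕ∞ :=
  ⨅ (l : List V) (_ : IsDiPath H u v l), (pathLength l : ℕ∞)

/-- The set of directed edges traversed by a path. -/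
def pathEdges {V : Type} (l : List V) : Set (V × V) := {e | e ∈ l.zip l.tail}

/-- The graph `H` with the directed edges in `S` removed. -/
def removeEdges {V : Type} (H : Digraph V) (S : Set (V × V)) : Digraph V where
  Adj u v := H.Adj u v ∧ (u, v) ∉ S

/-! ## Instances of the replacement paths problem -/

/-- An instance of the replacement paths problem on a network with `n` vertices: an unweighted
directed graph whose underlying undirected graph (the communication network) is connected,
pairwise distinct vertex identifiers, and a shortest path from `s` to `t`. -/
structure RPathsInstance (n : ℕ) where
  graph : Digraph (Fin n)
  connected : graph.toSimpleGraphInclusive.Connected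
  ident : Fin n → ℕ
  ident_injective : Function.Injective ident
  s : Fin n
  t : Fin n
  path : List (Fin n)
  path_isPath : IsDiPath graph s t path
  path_shortest : ∀ l, IsDiPath graph s t l → pathLength path ≤ pathLength l

namespace RPathsInstance

variable {n : ℕ} (I : RPathsInstance n)

/-- The communication network: the underlying undirected graph. -/
def network : SimpleGraph (Fin n) := I.graph.toSimpleGraphInclusive

/-- The length `|st ⋄ e|` of a shortest path from `s` to `t` that avoids the edge `e`. -/
noncomputable def replacementLength (e : Fin n × Fin n) : ℕ∞ :=
  diDist (removeEdges I.graph {e}) I.s I.t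

/-- `q` is a replacement path for the edge `(v_i, v_{i+1})` of `P = (v_0, …, v_h)` with detour `d`:
it follows `P` from `s = v_0` to some `v_j` with `j ≤ i`, then the path `d` from `v_j` to some
`v_l` with `l ≥ i + 1`, which shares no edge with `P`, and then `P` from `v_l` to `v_h = t`. -/
def IsReplacementPath (i : ℕ) (q d : List (Fin n)) : Prop :=
  ∃ (j l : ℕ) (hj : j < I.path.length) (hl : l < I.path.length),
    j ≤ i ∧ i + 1 ≤ l ∧
    IsDiPath (removeEdges I.graph (pathEdges I.path)) I.path[j] I.path[l] d ∧
    q = I.path.take j ++ d ++ I.path.drop (l + 1)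

/-- A detour is long if it has more than `ζ = n ^ (2 / 3)` hops. -/
def IsLongDetour (n : ℕ) (d : List (Fin n)) : Prop :=
  (n : ℝ) ^ (2 / 3 : ℝ) < (pathLength d : ℝ)

/-- The length of a shortest replacement path for `(v_i, v_{i+1})` that has a long detour;
it is `⊤` if there is none. -/
noncomputable def longDetourLength (i : ℕ) : ℕ∞ :=
  ⨅ (q : List (Fin n)) (d : List (Fin n))
    (_ : I.IsReplacementPath i q d ∧ IsLongDetour n d), (pathLength q : ℕ∞)

end RPathsInstance

/-! ## The CONGEST model -/

/-- What a vertex knows before the first round: its own identifier, the identifiers of its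
neighbours together with the directions of the incident edges, which incident edges lie on `P`,
and whether it is the source or the target. -/
structure LocalInput where
  ident : ℕ
  outNbrs : Set ℕ
  inNbrs : Set ℕ
  pathOut : Set ℕ
  pathIn : Set ℕ
  isSource : Prop
  isTarget : Prop

/-- The initial knowledge of the vertex `v`. -/
def RPathsInstance.localInput {n : ℕ} (I : RPathsInstance n) (v : Fin n) : LocalInput where
  ident := I.ident v
  outNbrs := {k | ∃ w, I.graph.Adj v w ∧ I.ident w = k}
  inNbrs := {k | ∃ w, I.graph.Adj w v ∧ I.ident w = k}
  pathOut := {k | ∃ w, (v, w) ∈ pathEdges I.path ∧ I.ident w = k}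
  pathIn := {k | ∃ w, (w, v) ∈ pathEdges I.path ∧ I.ident w = k}
  isSource := v = I.s
  isTarget := v = I.t

/-- A CONGEST algorithm whose messages have `B` bits, where every vertex has `R` private random
bits. All vertices run the same program; local computation is unrestricted.
* `init` is the initial state, from the initial knowledge and the random bits of the vertex;
* `send σ k` is the message, if any, that a vertex in state `σ` sends to its neighbour with
  identifier `k`;
* `recv σ M` is the new state, where `M` is the set of pairs (identifier of the sender, message)
  received in this round;
* `output σ = some x` means that a vertex in state `σ` has halted, with output `x`. -/
structure CongestAlgorithm (B R : ℕ) (Out : Type) where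
  State : Type
  init : LocalInput → (Fin R → Bool) → State
  send : State → ℕ → Option (BitVec B)
  recv : State → Set (ℕ × BitVec B) → State
  output : State → Option Out

namespace CongestAlgorithm

variable {B R n : ℕ} {Out : Type} (A : CongestAlgorithm B R Out) (I : RPathsInstance n)

/-- The messages received by `v` in a round which begins with the states `σ`. Vertices that have
halted send nothing. -/
def inbox (σ : Fin n → A.State) (v : Fin n) : Set (ℕ × BitVec B) :=
  {x | ∃ u, I.network.Adj v u ∧ A.output (σ u) = none ∧
    I.ident u = x.1 ∧ A.send (σ u) (I.ident v) = some x.2}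

/-- One synchronous round. Vertices that have halted keep their state. -/
def round (σ : Fin n → A.State) (v : Fin n) : A.State :=
  if (A.output (σ v)).isSome then σ v else A.recv (σ v) (A.inbox I σ v)

/-- The states of all vertices after `T` rounds, where `ω v` are the random bits of `v`. -/
def run (ω : Fin n → Fin R → Bool) : ℕ → Fin n → A.State
  | 0 => fun v => A.init (I.localInput v) (ω v)
  | T + 1 => A.round I (run ω T)

/-- All vertices have halted after at most `T` rounds. -/
def HaltsWithin (ω : Fin n → Fin R → Bool) (T : ℕ) : Prop :=
  ∀ v, (A.output (A.run I ω T v)).isSome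

end CongestAlgorithm

/-- The probability of the event `E` when every vertex has `R` independent fair random bits. -/
noncomputable def coinProb {n R : ℕ} (E : (Fin n → Fin R → Bool) → Prop) : ℝ :=
  (Nat.card {ω : Fin n → Fin R → Bool // E ω} : ℝ) / Nat.card (Fin n → Fin R → Bool)

/-- The outputs are correct after `T` rounds: for every edge `e = (v_i, v_{i+1})` of `P`, the
output `x` of `v_i` lies between `|st ⋄ e|` and the length of a shortest replacement path for `e`
with a long detour. -/
def LongDetourCorrect {B R n : ℕ} (A : CongestAlgorithm B R ℕ∞) (I : RPathsInstance n)
    (ω : Fin n → Fin R → Bool) (T : ℕ) : Prop :=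
  ∀ (i : ℕ) (hi : i + 1 < I.path.length), ∃ x : ℕ∞,
    A.output (A.run I ω T I.path[i]) = some x ∧
    I.replacementLength (I.path[i], I.path[i + 1]) ≤ x ∧
    x ≤ I.longDetourLength i

/-! Landmarks are sampled at random so that, with high probability, there are only `k = Õ(n^{1/3})`
of them, yet they meet every window of `ζ = ⌊n^{2/3}⌋` consecutive vertices of `P` and of one
shortest long detour for each pair of ends (`good_likely`). Such a detour consists of a hop of at
most `ζ` edges to a landmark, similar hops between landmarks, and a hop from a landmark back to `P`.
Simultaneous searches from all landmarks find the hops; the `O(k²) = Õ(n^{2/3})` distances between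
landmarks are broadcast to everybody, and each vertex combines them locally.

All communication is pipelined flooding: with at most `k` items, a code of value `d` or a better one
for its item has arrived after `d + k` rounds (`Flood.state_complete`).

For each landmark `x`, the vertex `v_i` also needs the minimum over `j ≤ i` of `j` plus the distance
from `v_j` to `x` off `P`. As `P` may be long, this is done in stretches of length `ζ`. A vertex `u`
at distance `d` after a landmark `y` of `P` and at distance `e` from `x` injects the value `e + 2d`
for the item `(x, y)`. After `r` steps along `P` it has become `(e + d) + (d + r)`; since `d + r`
depends only on `y` and the current vertex, flooding minimises `e + d`. Landmarks broadcast their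
minima, which serve all later stretches, and positions on `P` are sums of broadcast distances
between landmarks (`costs_sound`, `costs_complete`). The same computation on the reversed path
handles the end of the detour.

Every total so obtained is the length of an `s`–`t` walk avoiding the edge
(`replacementLength_le_finalAnswer`), and the best total is at most the length of any replacement
path with a long detour (`finalAnswer_le_longDetourLength`). The depth of the network is unknown to
the vertices and is found by doubling (`exec_probe`). The round count depends on the network only;
randomness affects just the correctness. -/

/-! ## Walks of prescribed length -/

/-- There is a walk with `m` steps of the relation `H` from `u` to `v`. -/
def HasWalk {V : Type} (H : V → V → Prop) : ℕ → V → V → Prop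
  | 0, u, v => u = v
  | m + 1, u, v => ∃ w, HasWalk H m u w ∧ H w v

namespace HasWalk

variable {V : Type} {H H' : V → V → Prop}

theorem single {u v : V} (h : H u v) : HasWalk H 1 u v := ⟨u, rfl, h⟩

theorem trans {l m : ℕ} {u v w : V} (h₁ : HasWalk H l u v) (h₂ : HasWalk H m v w) :
    HasWalk H (l + m) u w := by
  induction m generalizing w with
  | zero => cases h₂; exact h₁
  | succ m ih =>
    obtain ⟨x, hx, hxw⟩ := h₂
    exact ⟨x, ih hx, hxw⟩

theorem mono (hH : ∀ u v, H u v → H' u v) {m : ℕ} {u v : V} (h : HasWalk H m u v) :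
    HasWalk H' m u v := by
  induction m generalizing v with
  | zero => exact h
  | succ m ih =>
    obtain ⟨x, hx, hxw⟩ := h
    exact ⟨x, ih hx, hH _ _ hxw⟩

theorem swap {m : ℕ} {u v : V} (h : HasWalk H m u v) : HasWalk (fun a b => H b a) m v u := by
  induction m generalizing v with
  | zero => exact h.symm
  | succ m ih =>
    obtain ⟨x, hx, hxw⟩ := h
    have := (single (H := fun a b => H b a) hxw).trans (ih hx)
    rwa [add_comm] at this

end HasWalk

/-! ## Pipelined flooding

Every vertex `v` starts with a set `W v` of codes. A code `m` stands for the item `m % N` with the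
value `m / N`. In every round a vertex sends the least code that it has not sent yet and that is the
best one it knows for its item, and a received code gets its value increased by one. -/

namespace Flood

/-- The codes in `S` that are outside `X` and have the least value for their item. -/
def candidates (N : ℕ) (S X : Set ℕ) : Set ℕ :=
  {m | m ∈ S ∧ m ∉ X ∧ ∀ m' ∈ S, m' % N = m % N → m ≤ m'}

open Classical in
/-- The code to be sent next. -/
noncomputable def next (N : ℕ) (S X : Set ℕ) : Option ℕ :=
  if (candidates N S X).Nonempty then some (sInf (candidates N S X)) else none

/-- The sets of received and of treated codes after `t` rounds of flooding along `H`; only codes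
less than `L` are transmitted. -/
noncomputable def state {V : Type} (N L : ℕ) (H : V → V → Prop) (W : V → Set ℕ) :
    ℕ → V → Set ℕ × Set ℕ
  | 0, _ => (∅, ∅)
  | t + 1, v =>
    ((state N L H W t v).1 ∪ {m | ∃ u, H u v ∧ ∃ m',
        next N (W u ∪ (state N L H W t u).1) (state N L H W t u).2 = some m' ∧
        m' < L ∧ m = m' + N},
     (state N L H W t v).2 ∪
      {m | next N (W v ∪ (state N L H W t v).1) (state N L H W t v).2 = some m})

variable {V : Type} {N L : ℕ} {H : V → V → Prop} {W : V → Set ℕ}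

theorem next_mem {S X : Set ℕ} {m : ℕ} (h : next N S X = some m) : m ∈ candidates N S X := by
  unfold next at h
  split_ifs at h with hne
  rw [← Option.some.inj h]
  exact Nat.sInf_mem hne

theorem next_eq {S X : Set ℕ} {m : ℕ} (h : m ∈ candidates N S X)
    (hle : ∀ m' ∈ candidates N S X, m ≤ m') : next N S X = some m := by
  unfold next
  rw [if_pos ⟨m, h⟩]
  exact congrArg some (le_antisymm (Nat.sInf_le h) (hle _ (Nat.sInf_mem ⟨m, h⟩)))

/-- The codes that can arrive at `v`, the initial ones included. -/
def reachable (N : ℕ) (H : V → V → Prop) (W : V → Set ℕ) (v : V) : Set ℕ :=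
  {m | ∃ u r w, HasWalk H r u v ∧ w ∈ W u ∧ m = w + r * N}

/-- The codes of least value for their item that can arrive at `v`. -/
def optimal (N : ℕ) (H : V → V → Prop) (W : V → Set ℕ) (v : V) : Set ℕ :=
  {m | m ∈ reachable N H W v ∧ ∀ m' ∈ reachable N H W v, m' % N = m % N → m ≤ m'}

theorem subset_reachable (v : V) : W v ⊆ reachable N H W v :=
  fun w hw => ⟨v, 0, w, rfl, hw, by simp⟩

theorem reachable_step {u v : V} (h : H u v) {m : ℕ} (hm : m ∈ reachable N H W u) :
    m + N ∈ reachable N H W v := by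
  obtain ⟨x, r, w, hr, hw, rfl⟩ := hm
  exact ⟨x, r + 1, w, ⟨u, hr, h⟩, hw, by ring⟩

/-- Received codes come along nonempty walks from initial codes. -/
theorem state_sound (t : ℕ) (v : V) {m : ℕ} (hm : m ∈ (state N L H W t v).1) :
    ∃ u r w, HasWalk H (r + 1) u v ∧ w ∈ W u ∧ m = w + (r + 1) * N := by
  induction t generalizing v m with
  | zero => exact absurd hm (Set.notMem_empty m)
  | succ t ih =>
    rcases hm with hm | ⟨u, huv, m', hm', -, rfl⟩
    · exact ih v hm
    · rcases (next_mem hm').1 with h | h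
      · exact ⟨u, 0, m', HasWalk.single huv, h, by ring⟩
      · obtain ⟨x, r, w, hr, hw, rfl⟩ := ih u h
        exact ⟨x, r + 1, w, ⟨u, hr, huv⟩, hw, by ring⟩

theorem known_subset_reachable (t : ℕ) (v : V) :
    W v ∪ (state N L H W t v).1 ⊆ reachable N H W v := by
  rintro m (hm | hm)
  · exact subset_reachable v hm
  · obtain ⟨u, r, w, hr, hw, rfl⟩ := state_sound t v hm
    exact ⟨u, r + 1, w, hr, hw, rfl⟩

theorem state_mono {t t' : ℕ} (h : t ≤ t') (v : V) :
    (state N L H W t v).1 ⊆ (state N L H W t' v).1 ∧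
      (state N L H W t v).2 ⊆ (state N L H W t' v).2 := by
  induction t', h using Nat.le_induction with
  | base => exact ⟨subset_rfl, subset_rfl⟩
  | succ t' _ ih =>
    exact ⟨ih.1.trans Set.subset_union_left, ih.2.trans Set.subset_union_left⟩

/-- A treated code that is less than `L` has been sent to all neighbours. -/
theorem received_of_sent {t : ℕ} {u v : V} (h : H u v) {m : ℕ} (hL : m < L)
    (hm : m ∈ (state N L H W t u).2) : m + N ∈ (state N L H W t v).1 := by
  induction t with
  | zero => exact absurd hm (Set.notMem_empty m)
  | succ t ih =>
    rcases hm with hm | hm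
    · exact Or.inl (ih hm)
    · exact Or.inr ⟨u, h, m, hm, hL, rfl⟩

theorem exists_optimal_le {v : V} {m : ℕ} (hm : m ∈ reachable N H W v) :
    ∃ m' ∈ optimal N H W v, m' % N = m % N ∧ m' ≤ m := by
  classical
  have hne : ∃ m', m' ∈ reachable N H W v ∧ m' % N = m % N := ⟨m, hm, rfl⟩
  refine ⟨Nat.find hne, ⟨(Nat.find_spec hne).1, fun m' h h' => ?_⟩, (Nat.find_spec hne).2,
    Nat.find_min' hne ⟨hm, rfl⟩⟩
  exact Nat.find_min' hne ⟨h, h'.trans (Nat.find_spec hne).2⟩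

/-- The items that occur in the initial codes. -/
def items (N : ℕ) (W : V → Set ℕ) : Set ℕ := {x | ∃ u, ∃ w ∈ W u, w % N = x}

theorem mod_mem_items {v : V} {m : ℕ} (hm : m ∈ reachable N H W v) : m % N ∈ items N W := by
  obtain ⟨u, r, w, -, hw, rfl⟩ := hm
  exact ⟨u, w, hw, by simp⟩

/-- The items with an optimal code at `v` that is less than `m`. -/
def better (N : ℕ) (H : V → V → Prop) (W : V → Set ℕ) (v : V) (m : ℕ) : Set ℕ :=
  {x | ∃ m' ∈ optimal N H W v, m' < m ∧ m' % N = x}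

theorem better_subset_items (v : V) (m : ℕ) : better N H W v m ⊆ items N W := by
  rintro x ⟨m', hm', -, rfl⟩
  exact mod_mem_items hm'.1

/-- An optimal code can be delayed at a vertex only by smaller optimal codes, one round for each.
Hence it is known by the round "value plus rank" and treated one round later. The strong induction
on the code serves both the preceding vertex of the walk, where `m - N` is optimal, and the smaller
codes at `v`. -/
theorem state_complete_aux (hN : 0 < N) (hfin : (items N W).Finite) (m : ℕ) :
    ∀ v, m ∈ optimal N H W v → m < L →
      m ∈ W v ∪ (state N L H W (m / N + (better N H W v m).ncard) v).1 ∧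
      m ∈ (state N L H W (m / N + (better N H W v m).ncard + 1) v).2 := by
  induction m using Nat.strong_induction_on with
  | _ m ih =>
  intro v hm hL
  have hfin' : ∀ v m, (better N H W v m).Finite := fun v m =>
    hfin.subset (better_subset_items v m)
  have hknown : m ∈ W v ∪ (state N L H W (m / N + (better N H W v m).ncard) v).1 := by
    obtain ⟨⟨x, r, w, hr, hw, hmw⟩, hmin⟩ := hm
    cases r with
    | zero =>
      cases hr
      left
      simpa [hmw] using hw
    | succ r =>
      right
      obtain ⟨u, hru, huv⟩ := hr
      have hmN : m = (w + r * N) + N := by rw [hmw]; ring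
      have hu : w + r * N ∈ optimal N H W u := by
        refine ⟨⟨x, r, w, hru, hw, rfl⟩, fun m' hm' hmod => ?_⟩
        have := hmin _ (reachable_step huv hm') (by rw [hmN]; simpa using hmod)
        omega
      have hsent := (ih (w + r * N) (by omega) u hu (by omega)).2
      have hrec := received_of_sent huv (by omega) hsent
      rw [← hmN] at hrec
      refine (state_mono ?_ v).1 hrec
      have h1 : m / N = (w + r * N) / N + 1 := by rw [hmN, Nat.add_div_right _ hN]
      -- The rank cannot drop along the edge: an optimal code at `u` below `m - N` yields a code
      -- below `m` for the same item at `v`.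
      have h2 : (better N H W u (w + r * N)).ncard ≤ (better N H W v m).ncard := by
        refine Set.ncard_le_ncard ?_ (hfin' _ _)
        rintro y ⟨m', hm', hlt, rfl⟩
        obtain ⟨m'', ho, hmod, hle⟩ := exists_optimal_le (reachable_step huv hm'.1)
        exact ⟨m'', ho, by omega, by simpa using hmod⟩
      omega
  refine ⟨hknown, ?_⟩
  set t := m / N + (better N H W v m).ncard with ht
  by_cases hsent : m ∈ (state N L H W t v).2
  · exact (state_mono (Nat.le_succ t) v).2 hsent
  right
  -- Smaller optimal codes have strictly smaller rank and no larger value, so they have been treated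
  -- by round `t`.
  have hbefore : ∀ m' ∈ optimal N H W v, m' < m →
      m' ∈ W v ∪ (state N L H W t v).1 ∧ m' ∈ (state N L H W t v).2 := by
    intro m' hm' hlt
    obtain ⟨h1, h2⟩ := ih m' hlt v hm' (by omega)
    have hcard : (better N H W v m').ncard < (better N H W v m).ncard := by
      refine Set.ncard_lt_ncard ⟨?_, fun hsub => ?_⟩ (hfin' _ _)
      · rintro y ⟨m'', ho, hlt', rfl⟩
        exact ⟨m'', ho, by omega, rfl⟩
      · obtain ⟨m'', ho, hlt', hmod⟩ := hsub ⟨m', hm', hlt, rfl⟩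
        have := hm'.2 m'' ho.1 hmod
        omega
    have hdiv : m' / N ≤ m / N := Nat.div_le_div_right hlt.le
    refine ⟨?_, (state_mono (by omega) v).2 h2⟩
    rcases h1 with h1 | h1
    · exact Or.inl h1
    · exact Or.inr ((state_mono (by omega) v).1 h1)
  refine next_eq ⟨hknown, hsent, fun m' hm' => hm.2 m' (known_subset_reachable t v hm')⟩ ?_
  -- A smaller candidate would have to equal the optimal code of its item, which is already known;
  -- but that one has been treated.
  rintro m' ⟨hk, hns, hmin⟩
  by_contra! hlt
  obtain ⟨m'', ho, hmod, hle⟩ := exists_optimal_le (known_subset_reachable t v hk)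
  obtain ⟨h1, h2⟩ := hbefore m'' ho (by omega)
  have := hmin m'' h1 hmod
  exact hns (by rwa [show m' = m'' by omega])

/-- If there are at most `k` items, a code `w + (r + 1) * N` that can reach `v` along a nonempty walk
is received, or a better one for the same item, after `(w + (r + 1) * N) / N + k` rounds. -/
theorem state_complete (hN : 0 < N) (hfin : (items N W).Finite) {k : ℕ}
    (hk : (items N W).ncard ≤ k) {u v : V} {r w t : ℕ} (hr : HasWalk H (r + 1) u v)
    (hw : w ∈ W u) (hL : w + (r + 1) * N < L) (ht : (w + (r + 1) * N) / N + k ≤ t) :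
    ∃ m ∈ (state N L H W t v).1, m ≤ w + (r + 1) * N ∧ m % N = w % N := by
  obtain ⟨x, hrx, hxv⟩ := hr
  -- Optimality is used at the last vertex `x` before `v`: at `v` itself the optimal code might be
  -- initial, hence never received.
  obtain ⟨m, ho, hmod, hle⟩ :=
    exists_optimal_le (H := H) (v := x) (m := w + r * N) ⟨u, r, w, hrx, hw, rfl⟩
  have hs : w + (r + 1) * N = w + r * N + N := by ring
  rw [hs] at hL ht ⊢
  have hsent := (state_complete_aux (L := L) hN hfin m x ho (by omega)).2
  refine ⟨m + N, (state_mono ?_ v).1 (received_of_sent hxv (by omega) hsent), by omega,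
    by simpa using hmod⟩
  have h1 : (better N H W x m).ncard ≤ k :=
    (Set.ncard_le_ncard (better_subset_items x m) hfin).trans hk
  have h2 : m / N ≤ (w + r * N) / N := Nat.div_le_div_right hle
  rw [Nat.add_div_right _ hN] at ht
  omega

end Flood

/-! ## Programs made of flooding phases -/

/-- A local program: it halts with an output, or it takes part in a flooding phase of `len + 1`
rounds with the initial codes `W`, in which it sends to the neighbours with identifiers in `nb`, and
goes on depending on the set of received codes. -/
inductive Program : Type
  | halt (x : ℕ∞) : Program
  | phase (len : ℕ) (W nb : Set ℕ) (cont : Set ℕ → Program) : Program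

namespace Program

/-- The state of a vertex: the rest of its program, the number of rounds spent in the present phase,
the received and the treated codes. -/
structure VertexState where
  prog : Program
  count : ℕ
  received : Set ℕ
  treated : Set ℕ

/-- The state at the beginning of a program. -/
def start (p : Program) : VertexState := ⟨p, 0, ∅, ∅⟩

open Classical in
/-- The message sent to the neighbour with identifier `k`. -/
noncomputable def message (B N : ℕ) (σ : VertexState) (k : ℕ) : Option (BitVec B) :=
  match σ.prog with
  | halt _ => none
  | phase _ W nb _ =>
    if k ∈ nb then
      (Flood.next N (W ∪ σ.received) σ.treated).bind fun m =>
        if m < 2 ^ B then some (BitVec.ofNat B m) else none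
    else none

/-- The codes contained in a set of messages, with their values increased by one. -/
def decode {B : ℕ} (N : ℕ) (M : Set (ℕ × BitVec B)) : Set ℕ := {m | ∃ x ∈ M, m = x.2.toNat + N}

/-- The state after the messages `M` have been received. -/
noncomputable def step (B N : ℕ) (σ : VertexState) (M : Set (ℕ × BitVec B)) : VertexState :=
  match σ.prog with
  | halt _ => σ
  | phase len W _ cont =>
    -- The round with count `len` still delivers its messages, so a phase lasts `len + 1` rounds.
    if σ.count = len then start (cont (σ.received ∪ decode N M))
    else ⟨σ.prog, σ.count + 1, σ.received ∪ decode N M,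
      σ.treated ∪ {m | Flood.next N (W ∪ σ.received) σ.treated = some m}⟩

/-- The output of a vertex that has halted. -/
def result (σ : VertexState) : Option ℕ∞ :=
  match σ.prog with
  | halt x => some x
  | phase _ _ _ _ => none

/-- The algorithm in which the vertices execute the local programs `P`. -/
noncomputable def algorithm (B N R : ℕ) (P : LocalInput → (Fin R → Bool) → Program) :
    CongestAlgorithm B R ℕ∞ where
  State := VertexState
  init inp ω := start (P inp ω)
  send := message B N
  recv := step B N
  output := result

variable {n : ℕ} (I : RPathsInstance n) (B N : ℕ)

/-- The messages received by `v` in a round which begins with the states `σ`. -/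
def inbox (σ : Fin n → VertexState) (v : Fin n) : Set (ℕ × BitVec B) :=
  {x | ∃ u, I.network.Adj v u ∧ result (σ u) = none ∧
    I.ident u = x.1 ∧ message B N (σ u) (I.ident v) = some x.2}

/-- One synchronous round of the execution of programs. -/
noncomputable def roundMap (σ : Fin n → VertexState) (v : Fin n) : VertexState :=
  if (result (σ v)).isSome then σ v else step B N (σ v) (inbox I B N σ v)

/-- From programs `P` on, all vertices have halted after `T` rounds, with the outputs `o`. -/
def Exec (P : Fin n → Program) (T : ℕ) (o : Fin n → ℕ∞) : Prop :=
  ∀ v, result ((roundMap I B N)^[T] (fun v => start (P v)) v) = some (o v)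

theorem run_eq_iterate {R : ℕ} (P : LocalInput → (Fin R → Bool) → Program)
    (ω : Fin n → Fin R → Bool) (T : ℕ) :
    (algorithm B N R P).run I ω T =
      (roundMap I B N)^[T] (fun v => start (P (I.localInput v) (ω v))) := by
  induction T with
  | zero => rfl
  | succ T ih => rw [Function.iterate_succ_apply', ← ih]; rfl

theorem Exec.output_run {R : ℕ} {P : LocalInput → (Fin R → Bool) → Program}
    {ω : Fin n → Fin R → Bool} {T : ℕ} {o : Fin n → ℕ∞}
    (h : Exec I B N (fun v => P (I.localInput v) (ω v)) T o) (v : Fin n) :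
    (algorithm B N R P).output ((algorithm B N R P).run I ω T v) = some (o v) := by
  rw [run_eq_iterate]
  exact h v

theorem exec_halt (o : Fin n → ℕ∞) : Exec I B N (fun v => halt (o v)) 0 o :=
  fun _ => rfl

variable {B N}

/-- The directed edges of the network along which messages are sent if vertex `u` sends to the
neighbours with identifiers in `nb u`. -/
def edges (nb : Fin n → Set ℕ) (u v : Fin n) : Prop := I.network.Adj v u ∧ I.ident v ∈ nb u

/-- As all vertices are at the same round of the same phase, the messages exchanged are those of
`Flood.state`; encoding in `B` bits loses nothing because larger codes are not sent. -/
theorem round_phase {len : ℕ} {W nb : Fin n → Set ℕ} {cont : Fin n → Set ℕ → Program}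
    (t : ℕ) (v : Fin n) :
    roundMap I B N (fun v => ⟨phase len (W v) (nb v) (cont v), t,
        (Flood.state N (2 ^ B) (edges I nb) W t v).1,
        (Flood.state N (2 ^ B) (edges I nb) W t v).2⟩) v =
      if t = len then start (cont v (Flood.state N (2 ^ B) (edges I nb) W (t + 1) v).1)
      else ⟨phase len (W v) (nb v) (cont v), t + 1,
        (Flood.state N (2 ^ B) (edges I nb) W (t + 1) v).1,
        (Flood.state N (2 ^ B) (edges I nb) W (t + 1) v).2⟩ := by
  have key : decode N (inbox I B N (fun v =>
      (⟨phase len (W v) (nb v) (cont v), t,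
        (Flood.state N (2 ^ B) (edges I nb) W t v).1,
        (Flood.state N (2 ^ B) (edges I nb) W t v).2⟩ : VertexState)) v) =
      {m | ∃ u, edges I nb u v ∧ ∃ m',
        Flood.next N (W u ∪ (Flood.state N (2 ^ B) (edges I nb) W t u).1)
          (Flood.state N (2 ^ B) (edges I nb) W t u).2 = some m' ∧
        m' < 2 ^ B ∧ m = m' + N} := by
    ext m
    constructor
    · rintro ⟨x, ⟨u, hadj, -, -, hs⟩, rfl⟩
      simp only [message] at hs
      split_ifs at hs with hk
      obtain ⟨m', hm', hs⟩ := Option.bind_eq_some_iff.1 hs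
      split_ifs at hs with hlt
      refine ⟨u, ⟨hadj, hk⟩, m', hm', hlt, ?_⟩
      rw [← Option.some.inj hs, BitVec.toNat_ofNat, Nat.mod_eq_of_lt hlt]
    · rintro ⟨u, ⟨hadj, hk⟩, m', hm', hlt, rfl⟩
      refine ⟨(I.ident u, BitVec.ofNat B m'), ⟨u, hadj, rfl, rfl, ?_⟩, ?_⟩
      · simp [message, hk, hm', hlt]
      · simp [BitVec.toNat_ofNat, Nat.mod_eq_of_lt hlt]
  simp only [roundMap, result, step, Option.isSome_none, Bool.false_eq_true, if_false]
  rw [key]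
  rfl

/-- If all vertices begin a flooding phase of the same length, they go on with the codes received in
the flooding. -/
theorem exec_phase {len T : ℕ} {W nb : Fin n → Set ℕ} {cont : Fin n → Set ℕ → Program}
    {o : Fin n → ℕ∞}
    (h : Exec I B N
      (fun v => cont v (Flood.state N (2 ^ B) (edges I nb) W (len + 1) v).1) T o) :
    Exec I B N (fun v => phase len (W v) (nb v) (cont v)) (T + (len + 1)) o := by
  have hrun : ∀ t ≤ len, (roundMap I B N)^[t]
      (fun v => start (phase len (W v) (nb v) (cont v))) =
      fun v => ⟨phase len (W v) (nb v) (cont v), t,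
        (Flood.state N (2 ^ B) (edges I nb) W t v).1,
        (Flood.state N (2 ^ B) (edges I nb) W t v).2⟩ := by
    intro t
    induction t with
    | zero => intro _; rfl
    | succ t ih =>
      intro ht
      rw [Function.iterate_succ_apply', ih (by omega)]
      funext v
      rw [round_phase, if_neg (by omega)]
  intro v
  rw [Function.iterate_add_apply, Function.iterate_succ_apply', hrun len le_rfl]
  have : roundMap I B N (fun v => ⟨phase len (W v) (nb v) (cont v), len,
        (Flood.state N (2 ^ B) (edges I nb) W len v).1,
        (Flood.state N (2 ^ B) (edges I nb) W len v).2⟩) =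
      fun v => start (cont v (Flood.state N (2 ^ B) (edges I nb) W (len + 1) v).1) := by
    funext v
    rw [round_phase, if_pos rfl]
  rw [this]
  exact h v

end Program

/-! ## Estimating the diameter -/

theorem hasWalk_of_walk {V : Type} {G : SimpleGraph V} {u v : V} (p : G.Walk u v) :
    HasWalk (fun a b => G.Adj b a) p.length u v := by
  induction p with
  | nil => rfl
  | cons h p ih =>
    have := (HasWalk.single (H := fun a b => G.Adj b a) h.symm).trans ih
    rwa [add_comm] at this

theorem dist_le_of_hasWalk {V : Type} {G : SimpleGraph V} (hG : G.Connected) {m : ℕ} {u v : V}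
    (h : HasWalk (fun a b => G.Adj b a) m u v) : G.dist u v ≤ m := by
  induction m generalizing v with
  | zero => cases h; simp
  | succ m ih =>
    obtain ⟨w, hw, hwv⟩ := h
    have h1 := hG.dist_triangle (u := u) (v := w) (w := v)
    have h2 := SimpleGraph.dist_eq_one_iff_adj.2 hwv.symm
    have h3 := ih hw
    omega

theorem hasWalk_dist {V : Type} {G : SimpleGraph V} (hG : G.Connected) (u v : V) :
    HasWalk (fun a b => G.Adj b a) (G.dist u v) u v := by
  obtain ⟨p, hp⟩ := hG.exists_walk_length_eq_dist u v
  rw [← hp]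
  exact hasWalk_of_walk p

theorem SimpleGraph.Connected.dist_le_diam {V : Type} [Finite V] {G : SimpleGraph V}
    (hG : G.Connected) (u v : V) : G.dist u v ≤ G.diam := by
  have := hG.nonempty
  exact SimpleGraph.dist_le_diam (SimpleGraph.connected_iff_ediam_ne_top.1 hG)

theorem SimpleGraph.Connected.diam_lt_card {V : Type} [Fintype V] {G : SimpleGraph V}
    (hG : G.Connected) : G.diam < Fintype.card V := by
  have := hG.nonempty
  obtain ⟨u, v, huv⟩ := G.exists_dist_eq_diam
  obtain ⟨p, hp, hlen⟩ := hG.exists_path_of_dist u v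
  rw [← huv, ← hlen]
  exact hp.length_lt

namespace Program

open Classical in
/-- Search for a power of two `K` such that all vertices have distance at most `K` from the source,
and go on with `main K`: vertices that a flooding from the source does not reach within `K` rounds
start an alarm. -/
noncomputable def probe (N : ℕ) (main : ℕ → Program) (isSource : Prop) : ℕ → ℕ → Program
  -- Not reached from the initial fuel `n + 1`: the guess covers the diameter earlier.
  | 0, _ => halt ⊤
  | f + 1, K => phase K {m | isSource ∧ m = 0} Set.univ fun R =>
      -- The first flooding runs `K + 1` rounds and may reach distance `K + 1`; the test on the
      -- value cuts it back to `K`.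
      phase (2 * K + 1) {m | ¬(isSource ∨ ∃ m ∈ R, m / N ≤ K) ∧ m = 0} Set.univ fun R' =>
        if (isSource ∨ ∃ m ∈ R, m / N ≤ K) ∧ R' = ∅ then main K
        else probe N main isSource f (2 * K)

variable {n : ℕ} (I : RPathsInstance n) {B N : ℕ}

theorem edges_univ : edges I (fun _ => Set.univ) = fun u v => I.network.Adj v u := by
  funext u v
  simp [edges]

theorem items_zero_ncard_le {V : Type} {p : V → Prop} :
    (Flood.items N (fun v => {m | p v ∧ m = 0})).Finite ∧
      (Flood.items N (fun v => {m | p v ∧ m = 0})).ncard ≤ 1 := by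
  have : Flood.items N (fun v => {m | p v ∧ m = 0}) ⊆ {0} := by
    rintro x ⟨u, w, ⟨-, rfl⟩, rfl⟩
    simp
  refine ⟨(Set.finite_singleton 0).subset this, ?_⟩
  simpa using Set.ncard_le_ncard this

/-- All vertices reach the same verdict. If the ball of radius `K` around `s` is not everything, a
walk leaves it through a vertex at distance at most `K + 1`, whose alarm needs at most `(K + 1) + K`
steps to any vertex of the ball; vertices outside the ball reject on their own. -/
theorem probe_test (hN : 0 < N) {K : ℕ} (hB : (2 * K + 1) * N < 2 ^ B) (W₁ W₂ : Fin n → Set ℕ)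
    (R R' : Fin n → Set ℕ)
    (hW₁ : W₁ = fun v => {m | v = I.s ∧ m = 0})
    (hR : R = fun v => (Flood.state N (2 ^ B) (edges I fun _ => Set.univ) W₁ (K + 1) v).1)
    (hW₂ : W₂ = fun v => {m | ¬(v = I.s ∨ ∃ m ∈ R v, m / N ≤ K) ∧ m = 0})
    (hR' : R' = fun v =>
      (Flood.state N (2 ^ B) (edges I fun _ => Set.univ) W₂ (2 * K + 1 + 1) v).1) (v : Fin n) :
    ((v = I.s ∨ ∃ m ∈ R v, m / N ≤ K) ∧ R' v = ∅) ↔ ∀ u, I.network.dist I.s u ≤ K := by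
  have hG : I.network.Connected := I.connected
  have hreach : ∀ v, (v = I.s ∨ ∃ m ∈ R v, m / N ≤ K) ↔ I.network.dist I.s v ≤ K := by
    intro v
    constructor
    · rintro (rfl | ⟨m, hm, hle⟩)
      · simp
      · rw [hR] at hm
        obtain ⟨u, r, w, hr, hw, rfl⟩ := Flood.state_sound _ v hm
        rw [hW₁] at hw
        obtain ⟨rfl, rfl⟩ := hw
        rw [zero_add, Nat.mul_div_cancel _ hN] at hle
        rw [edges_univ] at hr
        exact (dist_le_of_hasWalk hG hr).trans hle
    · intro hd
      by_cases hv : v = I.s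
      · exact Or.inl hv
      right
      have hpos := hG.pos_dist_of_ne (Ne.symm hv)
      obtain ⟨r, hr⟩ : ∃ r, I.network.dist I.s v = r + 1 := ⟨_, (Nat.sub_add_cancel hpos).symm⟩
      have hw := hasWalk_dist hG I.s v
      rw [hr] at hw hd
      have hit := items_zero_ncard_le (N := N) (p := fun v => v = I.s)
      rw [← hW₁] at hit
      have hlt : (r + 1) * N ≤ (2 * K + 1) * N := Nat.mul_le_mul_right N (by omega)
      obtain ⟨m, hm, hle, -⟩ := Flood.state_complete (L := 2 ^ B)
        (H := edges I fun _ => Set.univ) (W := W₁) hN hit.1 hit.2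
        (u := I.s) (v := v) (r := r) (w := 0) (t := K + 1) (by rw [edges_univ]; exact hw)
        (by rw [hW₁]; exact ⟨rfl, rfl⟩) (by omega)
        (by rw [zero_add, Nat.mul_div_cancel _ hN]; omega)
      refine ⟨m, by rw [hR]; exact hm, ?_⟩
      rw [zero_add] at hle
      calc m / N ≤ (r + 1) * N / N := Nat.div_le_div_right hle
        _ = r + 1 := Nat.mul_div_cancel _ hN
        _ ≤ K := hd
  rw [hreach]
  constructor
  · rintro ⟨hv, hemp⟩
    by_contra! hfar
    obtain ⟨u, hu⟩ := hfar
    obtain ⟨p⟩ := hG I.s u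
    obtain ⟨d, -, hd1, hd2⟩ := p.exists_boundary_dart {x | I.network.dist I.s x ≤ K}
      (by simp) (by simpa using hu)
    simp only [Set.mem_ofPred_eq, not_le] at hd1 hd2
    have hdist : I.network.dist d.snd v ≤ 2 * K + 1 := by
      have h1 := hG.dist_triangle (u := d.snd) (v := I.s) (w := v)
      have h2 := hG.dist_triangle (u := I.s) (v := d.fst) (w := d.snd)
      have h3 := SimpleGraph.dist_eq_one_iff_adj.2 d.adj
      rw [SimpleGraph.dist_comm (u := d.snd) (v := I.s)] at h1
      omega
    have hne : d.snd ≠ v := by rintro rfl; omega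
    have hpos := hG.pos_dist_of_ne hne
    obtain ⟨r, hr⟩ : ∃ r, I.network.dist d.snd v = r + 1 := ⟨_, (Nat.sub_add_cancel hpos).symm⟩
    have hw := hasWalk_dist hG d.snd v
    rw [hr] at hw hdist
    have hit := items_zero_ncard_le (N := N) (p := fun v => ¬(v = I.s ∨ ∃ m ∈ R v, m / N ≤ K))
    rw [← hW₂] at hit
    have hlt : (r + 1) * N ≤ (2 * K + 1) * N := Nat.mul_le_mul_right N (by omega)
    obtain ⟨m, hm, -, -⟩ := Flood.state_complete (L := 2 ^ B)
      (H := edges I fun _ => Set.univ) (W := W₂) hN hit.1 hit.2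
      (u := d.snd) (v := v) (r := r) (w := 0) (t := 2 * K + 1 + 1) (by rw [edges_univ]; exact hw)
      (by rw [hW₂]; exact ⟨by rw [hreach]; omega, rfl⟩) (by omega)
      (by rw [zero_add, Nat.mul_div_cancel _ hN]; omega)
    have : m ∈ R' v := by rw [hR']; exact hm
    rw [hemp] at this
    exact this
  · intro hall
    refine ⟨hall v, Set.eq_empty_iff_forall_notMem.2 fun m hm => ?_⟩
    rw [hR'] at hm
    obtain ⟨u, r, w, -, hw, -⟩ := Flood.state_sound _ v hm
    rw [hW₂] at hw
    exact hw.1 ((hreach u).2 (hall u))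

/-- The search ends with the same `K` at all vertices, within `O(K)` rounds. -/
theorem exec_probe (hN : 0 < N) (hB : (4 * n + 3) * N < 2 ^ B) (f K : ℕ) (hK : 1 ≤ K)
    (hf : I.network.diam ≤ K * 2 ^ f) (hKd : K ≤ 2 * I.network.diam + 1) :
    ∃ K' T, (∀ u, I.network.dist I.s u ≤ K') ∧ K' ≤ 2 * I.network.diam + 1 ∧
      T + 6 * K ≤ 12 * K' ∧
      ∀ (main : Fin n → ℕ → Program) (T' : ℕ) (o : Fin n → ℕ∞),
        Exec I B N (fun v => main v K') T' o →
        Exec I B N (fun v => probe N (main v) (v = I.s) (f + 1) K) (T' + T) o := by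
  have hG : I.network.Connected := I.connected
  induction f generalizing K with
  | zero =>
    have hall : ∀ u, I.network.dist I.s u ≤ K := fun u => (hG.dist_le_diam _ _).trans (by simpa using hf)
    refine ⟨K, 2 * K + 1 + 1 + (K + 1), hall, hKd, by omega, fun main T' o h => ?_⟩
    rw [← add_assoc]
    refine exec_phase I (W := fun v => {m | v = I.s ∧ m = 0}) (nb := fun _ => Set.univ) ?_
    refine exec_phase I (W := fun v => {m | ¬(v = I.s ∨ ∃ m ∈ _, m / N ≤ K) ∧ m = 0})
      (nb := fun _ => Set.univ) ?_
    convert h using 2 with v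
    refine if_pos ((probe_test I hN ?_ _ _ _ _ rfl rfl rfl rfl v).2 hall)
    refine lt_of_le_of_lt (Nat.mul_le_mul_right N ?_) hB
    have := hG.diam_lt_card
    simp only [Fintype.card_fin] at this
    omega
  | succ f ih =>
    have hB' : (2 * K + 1) * N < 2 ^ B := by
      refine lt_of_le_of_lt (Nat.mul_le_mul_right N ?_) hB
      have := hG.diam_lt_card
      simp only [Fintype.card_fin] at this
      omega
    by_cases hall : ∀ u, I.network.dist I.s u ≤ K
    · refine ⟨K, 2 * K + 1 + 1 + (K + 1), hall, hKd, by omega, fun main T' o h => ?_⟩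
      rw [← add_assoc]
      refine exec_phase I (W := fun v => {m | v = I.s ∧ m = 0}) (nb := fun _ => Set.univ) ?_
      refine exec_phase I (W := fun v => {m | ¬(v = I.s ∨ ∃ m ∈ _, m / N ≤ K) ∧ m = 0})
        (nb := fun _ => Set.univ) ?_
      convert h using 2 with v
      exact if_pos ((probe_test I hN hB' _ _ _ _ rfl rfl rfl rfl v).2 hall)
    · have hlt : K < I.network.diam := by
        push Not at hall
        obtain ⟨u, hu⟩ := hall
        exact hu.trans_le (hG.dist_le_diam _ _)
      obtain ⟨K', T, h1, h2, h3, h4⟩ := ih (2 * K) (by omega) (by rw [pow_succ] at hf; linarith)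
        (by omega)
      -- The failed guess costs `3 * K + 3 ≤ 6 * K` rounds, which the bound `T + 12 * K ≤ 12 * K'`
      -- for the doubled guess absorbs.
      refine ⟨K', T + (2 * K + 1 + 1 + (K + 1)), h1, h2, by omega, fun main T' o h => ?_⟩
      rw [← add_assoc, ← add_assoc]
      refine exec_phase I (W := fun v => {m | v = I.s ∧ m = 0}) (nb := fun _ => Set.univ) ?_
      refine exec_phase I (W := fun v => {m | ¬(v = I.s ∨ ∃ m ∈ _, m / N ≤ K) ∧ m = 0})
        (nb := fun _ => Set.univ) ?_
      convert h4 main T' o h using 2 with v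
      exact if_neg fun hc => hall ((probe_test I hN hB' _ _ _ _ rfl rfl rfl rfl v).1 hc)

end Program

/-! ## The two symmetric halves of the computation -/

/-- A statement about the vertices with identifiers `a` and `b` and the number `r`, as a number. -/
def fact (kind a b r : ℕ) : ℕ := Nat.pair kind (Nat.pair a (Nat.pair b r))

theorem fact_inj {k a b r k' a' b' r' : ℕ} :
    fact k a b r = fact k' a' b' r' ↔ k = k' ∧ a = a' ∧ b = b' ∧ r = r' := by
  simp [fact, Nat.pair_eq_pair]

theorem pair_lt_sq {S a b : ℕ} (ha : a < S) (hb : b < S) : Nat.pair a b < S ^ 2 := by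
  refine (Nat.pair_lt_max_add_one_sq a b).trans_le (Nat.pow_le_pow_left ?_ 2)
  have := max_lt ha hb
  omega

/-- Each of the three nested pairings squares the bound: `S ^ 2`, `S ^ 4`, `S ^ 8`. Hence the
modulus `S ^ 8` for items. -/
theorem fact_lt {S k a b r : ℕ} (hk : k < S) (ha : a < S) (hb : b < S) (hr : r < S) :
    fact k a b r < S ^ 8 := by
  have h1 : S ≤ S ^ 2 := Nat.le_self_pow two_ne_zero S
  have h2 : S ^ 2 ≤ (S ^ 2) ^ 2 := Nat.le_self_pow two_ne_zero _
  have h3 := pair_lt_sq (ha.trans_le h1) (pair_lt_sq hb hr)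
  have h4 := pair_lt_sq (hk.trans_le (h1.trans h2)) h3
  rwa [← pow_mul, ← pow_mul] at h4

/-- What a vertex contributes to one half of the computation. -/
structure HalfInput where
  ident : ℕ
  offIn : Set ℕ
  pathOut : Set ℕ
  isStart : Prop
  isLandmark : Prop

/-- What a vertex knows after one half of the computation: codes for distances to landmarks off the
path, codes for the distances from landmarks along the path, codes received in the pipelined
minimum, and the facts that have been broadcast. -/
structure HalfResult where
  off : Set ℕ
  along : Set ℕ
  pref : Set ℕ
  facts : Set ℕ

/-- The initial codes for the floodings from landmarks. -/
def landmarkCodes (a : HalfInput) : Set ℕ := {m | a.isLandmark ∧ m = a.ident}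

/-- The initial codes for the minimum over prefixes of the path. -/
def prefixCodes (N ζ : ℕ) (E D : Set ℕ) : Set ℕ :=
  {m | ∃ e ∈ E, ∃ d ∈ D, e / N ≤ ζ ∧ d / N ≤ ζ ∧
    -- The factor 2 compensates for the increase by one per step along the path: codes for the same
    -- pair of landmarks then compare at every vertex as `e + d` does.
    m = (e / N + 2 * (d / N)) * N + Nat.pair (e % N) (d % N)}

/-- The values that the codes in `E` have for the item `x`. -/
def values (N : ℕ) (E : Set ℕ) (x : ℕ) : Set ℕ := {r | ∃ e ∈ E, e % N = x ∧ e / N = r}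

/-- The candidates for the cost of a prefix, relative to the position of the vertex. -/
def relativeCosts (N ζ : ℕ) (D Q : Set ℕ) (x : ℕ) : Set ℕ :=
  -- Subtracting the distance to the reference landmark twice leaves the cost minus the position of
  -- the vertex, possibly negative; the shift by `2 * ζ` makes it a natural number.
  {r | ∃ q ∈ Q, ∃ d ∈ D, d / N ≤ ζ ∧ q % N = Nat.pair x (d % N) ∧ r + 2 * (d / N) = q / N + 2 * ζ}

/-- The facts that a vertex broadcasts. -/
def ownFacts (N ζ : ℕ) (a : HalfInput) (E D Q : Set ℕ) : Set ℕ :=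
  {m | (a.isLandmark ∧ ∃ x r, IsLeast (values N E x) r ∧ r ≤ ζ ∧ m = fact 0 a.ident x r) ∨
    (a.isLandmark ∧ ∃ x r, IsLeast (values N D x) r ∧ r ≤ ζ ∧ m = fact 1 a.ident x r) ∨
    (a.isStart ∧ m = fact 2 a.ident 0 0) ∨
    (a.isLandmark ∧ ∃ x r, IsLeast (relativeCosts N ζ D Q x) r ∧ r ≤ 3 * ζ ∧
      m = fact 3 a.ident x r)}

namespace Program

/-- One half of the computation. -/
def half (N ζ len : ℕ) (a : HalfInput) (cont : HalfResult → Program) : Program :=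
  phase len (landmarkCodes a) a.offIn fun R₁ =>
  phase len (landmarkCodes a) a.pathOut fun R₂ =>
  phase len (prefixCodes N ζ (landmarkCodes a ∪ R₁) (landmarkCodes a ∪ R₂)) a.pathOut fun R₃ =>
  phase len (ownFacts N ζ a (landmarkCodes a ∪ R₁) (landmarkCodes a ∪ R₂)
    (prefixCodes N ζ (landmarkCodes a ∪ R₁) (landmarkCodes a ∪ R₂) ∪ R₃)) Set.univ fun R₄ =>
  cont ⟨landmarkCodes a ∪ R₁, landmarkCodes a ∪ R₂, R₃,
    (fun m => m % N) '' (ownFacts N ζ a (landmarkCodes a ∪ R₁) (landmarkCodes a ∪ R₂)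
      (prefixCodes N ζ (landmarkCodes a ∪ R₁) (landmarkCodes a ∪ R₂) ∪ R₃) ∪ R₄)⟩

section Half

variable {n : ℕ} (I : RPathsInstance n) (B N ζ len : ℕ) (inp : Fin n → HalfInput)

/-- The codes known after the flooding off the path. -/
def offCodes (v : Fin n) : Set ℕ := landmarkCodes (inp v) ∪
  (Flood.state N (2 ^ B) (edges I fun v => (inp v).offIn) (fun v => landmarkCodes (inp v))
    (len + 1) v).1

/-- The codes known after the flooding along the path. -/
def alongCodes (v : Fin n) : Set ℕ := landmarkCodes (inp v) ∪
  (Flood.state N (2 ^ B) (edges I fun v => (inp v).pathOut) (fun v => landmarkCodes (inp v))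
    (len + 1) v).1

/-- The codes with which the pipelined minimum along the path begins. -/
def ownPrefixCodes (v : Fin n) : Set ℕ :=
  prefixCodes N ζ (offCodes I B N len inp v) (alongCodes I B N len inp v)

/-- The codes received in the pipelined minimum along the path. -/
def receivedPrefixCodes (v : Fin n) : Set ℕ :=
  (Flood.state N (2 ^ B) (edges I fun v => (inp v).pathOut) (ownPrefixCodes I B N ζ len inp)
    (len + 1) v).1

/-- The facts broadcast by `v`. -/
def broadcastFacts (v : Fin n) : Set ℕ :=
  ownFacts N ζ (inp v) (offCodes I B N len inp v) (alongCodes I B N len inp v)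
    (ownPrefixCodes I B N ζ len inp v ∪ receivedPrefixCodes I B N ζ len inp v)

/-- What `v` knows after one half of the computation. -/
def halfResult (v : Fin n) : HalfResult where
  off := offCodes I B N len inp v
  along := alongCodes I B N len inp v
  pref := receivedPrefixCodes I B N ζ len inp v
  facts := (fun m => m % N) '' (broadcastFacts I B N ζ len inp v ∪
    (Flood.state N (2 ^ B) (edges I fun _ => Set.univ) (broadcastFacts I B N ζ len inp)
      (len + 1) v).1)

theorem exec_half {cont : Fin n → HalfResult → Program} {T : ℕ} {o : Fin n → ℕ∞}
    (h : Exec I B N (fun v => cont v (halfResult I B N ζ len inp v)) T o) :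
    Exec I B N (fun v => half N ζ len (inp v) (cont v)) (T + 4 * (len + 1)) o := by
  have : T + 4 * (len + 1) = T + (len + 1) + (len + 1) + (len + 1) + (len + 1) := by ring
  rw [this]
  refine exec_phase I (W := fun v => landmarkCodes (inp v)) (nb := fun v => (inp v).offIn) ?_
  refine exec_phase I (W := fun v => landmarkCodes (inp v)) (nb := fun v => (inp v).pathOut) ?_
  refine exec_phase I (W := ownPrefixCodes I B N ζ len inp) (nb := fun v => (inp v).pathOut) ?_
  exact exec_phase I (W := broadcastFacts I B N ζ len inp) (nb := fun _ => Set.univ) h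

end Half

end Program

open Program in
/-- The situation in which one half of the computation takes place: a path `p`, a relation `H` off
the path, and a set of landmarks. -/
structure LineSetting {n : ℕ} (I : RPathsInstance n) (B S ζ K k len : ℕ) where
  H : Fin n → Fin n → Prop
  p : List (Fin n)
  landmarks : Set (Fin n)
  inp : Fin n → HalfInput
  nodup : p.Nodup
  ident_eq : ∀ v, (inp v).ident = I.ident v
  edges_off : ∀ u v, edges I (fun v => (inp v).offIn) u v ↔ H v u
  edges_path : ∀ u v, edges I (fun v => (inp v).pathOut) u v ↔ (u, v) ∈ pathEdges p
  start_iff : ∀ v, (inp v).isStart ↔ p.head? = some v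
  landmark_iff : ∀ v, (inp v).isLandmark ↔ v ∈ landmarks
  card_le : landmarks.ncard ≤ k
  ident_lt : ∀ v, I.ident v < S
  four_le : 4 ≤ S
  zeta_lt : 3 * ζ < S
  dist_le : ∀ u v, I.network.dist u v ≤ 2 * K
  -- One length for all phases: the searches need `ζ + k` rounds, the prefix minimum `4 * ζ + k ^ 2`
  -- (values up to `ζ + 2 * ζ + ζ`), the broadcast `2 * K + 3 * k ^ 2 + 1`.
  le_len : 4 * ζ + 2 * K + 3 * k ^ 2 + 1 ≤ len
  len_le : (len + 1) * S ^ 8 ≤ 2 ^ B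

/-! ### Meaning of the codes collected in one half -/

namespace LineSetting

open Program

variable {n : ℕ} {I : RPathsInstance n} {B S ζ K k len : ℕ} (A : LineSetting I B S ζ K k len)

/-- The steps of the path. -/
def step (u v : Fin n) : Prop := (u, v) ∈ pathEdges A.p

/-- The codes known after the flooding off the path. -/
def off (v : Fin n) : Set ℕ := (halfResult I B (S ^ 8) ζ len A.inp v).off

/-- The codes known after the flooding along the path. -/
def along (v : Fin n) : Set ℕ := (halfResult I B (S ^ 8) ζ len A.inp v).along

/-- The codes received in the pipelined minimum along the path. -/
def pref (v : Fin n) : Set ℕ := (halfResult I B (S ^ 8) ζ len A.inp v).pref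

/-- The codes known after the pipelined minimum along the path. -/
def allPref (v : Fin n) : Set ℕ := prefixCodes (S ^ 8) ζ (A.off v) (A.along v) ∪ A.pref v

/-- The facts broadcast by `v`. -/
def own (v : Fin n) : Set ℕ := broadcastFacts I B (S ^ 8) ζ len A.inp v

/-- The facts known after the broadcast. -/
def facts (v : Fin n) : Set ℕ := (halfResult I B (S ^ 8) ζ len A.inp v).facts

theorem pow_pos (A : LineSetting I B S ζ K k len) : 0 < S ^ 8 := Nat.pow_pos (by have := A.four_le; omega)

theorem ident_lt_pow (A : LineSetting I B S ζ K k len) (v : Fin n) : I.ident v < S ^ 8 :=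
  (A.ident_lt v).trans_le (Nat.le_self_pow (by norm_num) S)

theorem pair_ident_lt_pow (A : LineSetting I B S ζ K k len) (u v : Fin n) :
    Nat.pair (I.ident u) (I.ident v) < S ^ 8 :=
  (pair_lt_sq (A.ident_lt u) (A.ident_lt v)).trans_le
    (Nat.pow_le_pow_right (by have := A.four_le; omega) (by norm_num))

theorem mem_landmarkCodes {v : Fin n} {m : ℕ} :
    m ∈ landmarkCodes (A.inp v) ↔ v ∈ A.landmarks ∧ m = I.ident v := by
  simp [landmarkCodes, A.landmark_iff, A.ident_eq]

theorem flood_landmarks_sound {nb : Fin n → Set ℕ} {v : Fin n} {m : ℕ}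
    (hm : m ∈ landmarkCodes (A.inp v) ∪ (Flood.state (S ^ 8) (2 ^ B) (edges I nb)
      (fun v => landmarkCodes (A.inp v)) (len + 1) v).1) :
    ∃ x ∈ A.landmarks, m % S ^ 8 = I.ident x ∧ HasWalk (edges I nb) (m / S ^ 8) x v := by
  obtain ⟨x, r, w, hr, hw, rfl⟩ := Flood.known_subset_reachable
    (W := fun v => landmarkCodes (A.inp v)) _ v hm
  obtain ⟨hx, rfl⟩ := A.mem_landmarkCodes.1 hw
  have hlt := A.ident_lt_pow x
  refine ⟨x, hx, ?_, ?_⟩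
  · rw [Nat.add_mul_mod_self_right, Nat.mod_eq_of_lt hlt]
  · rwa [Nat.add_mul_div_right _ _ A.pow_pos, Nat.div_eq_of_lt hlt, zero_add]

theorem flood_landmarks_complete {nb : Fin n → Set ℕ} {v x : Fin n} (hx : x ∈ A.landmarks) {r : ℕ}
    (hr : HasWalk (edges I nb) r x v) (hζ : r ≤ ζ) :
    ∃ m ∈ landmarkCodes (A.inp v) ∪ (Flood.state (S ^ 8) (2 ^ B) (edges I nb)
      (fun v => landmarkCodes (A.inp v)) (len + 1) v).1,
      m % S ^ 8 = I.ident x ∧ m / S ^ 8 ≤ r := by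
  have hlt := A.ident_lt_pow x
  cases r with
  | zero =>
    obtain rfl : x = v := hr
    exact ⟨I.ident x, Or.inl (A.mem_landmarkCodes.2 ⟨hx, rfl⟩), Nat.mod_eq_of_lt hlt,
      by rw [Nat.div_eq_of_lt hlt]⟩
  | succ r =>
    have hsub : Flood.items (S ^ 8) (fun v => landmarkCodes (A.inp v)) ⊆
        I.ident '' A.landmarks := by
      rintro y ⟨u, w, hw, rfl⟩
      obtain ⟨hu, rfl⟩ := A.mem_landmarkCodes.1 hw
      exact ⟨u, hu, (Nat.mod_eq_of_lt (A.ident_lt_pow u)).symm⟩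
    have hfin : (I.ident '' A.landmarks).Finite := (Set.toFinite _).image _
    have hcard : (I.ident '' A.landmarks).ncard ≤ k :=
      (Set.ncard_image_le (Set.toFinite _)).trans A.card_le
    have hlen := A.le_len
    have hk : k ≤ k ^ 2 := Nat.le_self_pow two_ne_zero k
    have hbound : (I.ident x + (r + 1) * S ^ 8) < (len + 1) * S ^ 8 := by
      have : (r + 2) * S ^ 8 ≤ (len + 1) * S ^ 8 := Nat.mul_le_mul_right _ (by omega)
      linarith
    have hdiv : (I.ident x + (r + 1) * S ^ 8) / S ^ 8 = r + 1 := by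
      rw [Nat.add_mul_div_right _ _ A.pow_pos, Nat.div_eq_of_lt hlt, zero_add]
    obtain ⟨m, hm, hle, hmod⟩ := Flood.state_complete (L := 2 ^ B) (H := edges I nb)
      (W := fun v => landmarkCodes (A.inp v)) A.pow_pos (hfin.subset hsub)
      ((Set.ncard_le_ncard hsub hfin).trans hcard) hr
      (A.mem_landmarkCodes.2 ⟨hx, rfl⟩) (hbound.trans_le A.len_le) (t := len + 1)
      (by rw [hdiv]; omega)
    exact ⟨m, Or.inr hm, hmod.trans (Nat.mod_eq_of_lt hlt), (Nat.div_le_div_right hle).trans hdiv.le⟩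

/-- Messages run against the edges of `A.H`, so a vertex learns distances to landmarks; hence the
reversal of the walk. -/
theorem off_sound {v : Fin n} {e : ℕ} (he : e ∈ A.off v) :
    ∃ x ∈ A.landmarks, e % S ^ 8 = I.ident x ∧ HasWalk A.H (e / S ^ 8) v x := by
  obtain ⟨x, hx, h1, h2⟩ := A.flood_landmarks_sound he
  exact ⟨x, hx, h1, h2.swap.mono fun u w => (A.edges_off w u).1⟩

theorem off_complete {v x : Fin n} (hx : x ∈ A.landmarks) {r : ℕ} (hr : HasWalk A.H r v x)
    (hζ : r ≤ ζ) : ∃ e ∈ A.off v, e % S ^ 8 = I.ident x ∧ e / S ^ 8 ≤ r :=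
  A.flood_landmarks_complete hx (hr.swap.mono fun u w => (A.edges_off u w).2) hζ

theorem along_sound {v : Fin n} {d : ℕ} (hd : d ∈ A.along v) :
    ∃ x ∈ A.landmarks, d % S ^ 8 = I.ident x ∧ HasWalk A.step (d / S ^ 8) x v := by
  obtain ⟨x, hx, h1, h2⟩ := A.flood_landmarks_sound hd
  exact ⟨x, hx, h1, h2.mono fun u w => (A.edges_path u w).1⟩

theorem along_complete {v x : Fin n} (hx : x ∈ A.landmarks) {r : ℕ} (hr : HasWalk A.step r x v)
    (hζ : r ≤ ζ) : ∃ d ∈ A.along v, d % S ^ 8 = I.ident x ∧ d / S ^ 8 ≤ r :=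
  A.flood_landmarks_complete hx (hr.mono fun u w => (A.edges_path u w).2) hζ

/-- The code `q` stands for a detour that begins `r` steps before `v` on the path, at `u`. -/
def Witness (v : Fin n) (q r : ℕ) : Prop :=
  ∃ u e d, e ∈ A.off u ∧ d ∈ A.along u ∧ e / S ^ 8 ≤ ζ ∧ d / S ^ 8 ≤ ζ ∧ HasWalk A.step r u v ∧
    q % S ^ 8 = Nat.pair (e % S ^ 8) (d % S ^ 8) ∧ q / S ^ 8 = e / S ^ 8 + 2 * (d / S ^ 8) + r

theorem pair_mod_lt {u : Fin n} {e d : ℕ} (he : e ∈ A.off u) (hd : d ∈ A.along u) :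
    Nat.pair (e % S ^ 8) (d % S ^ 8) < S ^ 8 := by
  obtain ⟨x, -, hx, -⟩ := A.off_sound he
  obtain ⟨y, -, hy, -⟩ := A.along_sound hd
  rw [hx, hy]
  exact A.pair_ident_lt_pow x y

/-- A received code has made at least one step. This strictness makes the detours of the backward
half end after the failing edge. -/
theorem pref_witness {v : Fin n} {q : ℕ} (hq : q ∈ A.pref v) : ∃ r, A.Witness v q (r + 1) := by
  obtain ⟨u, r, w, hr, ⟨e, he, d, hd, h1, h2, rfl⟩, rfl⟩ := Flood.state_sound _ v hq
  have hlt := A.pair_mod_lt he hd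
  refine ⟨r, u, e, d, he, hd, h1, h2, hr.mono fun u w => (A.edges_path u w).1, ?_, ?_⟩
  · rw [Nat.add_mul_mod_self_right, Nat.mul_add_mod_self_right, Nat.mod_eq_of_lt hlt]
  · rw [Nat.add_mul_div_right _ _ A.pow_pos, mul_comm _ (S ^ 8), Nat.mul_add_div A.pow_pos,
      Nat.div_eq_of_lt hlt, add_zero]

theorem allPref_witness {v : Fin n} {q : ℕ} (hq : q ∈ A.allPref v) : ∃ r, A.Witness v q r := by
  rcases hq with ⟨e, he, d, hd, h1, h2, rfl⟩ | hq
  · have hlt := A.pair_mod_lt he hd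
    refine ⟨0, v, e, d, he, hd, h1, h2, rfl, ?_, ?_⟩
    · rw [Nat.mul_add_mod_self_right, Nat.mod_eq_of_lt hlt]
    · rw [mul_comm, Nat.mul_add_div A.pow_pos, Nat.div_eq_of_lt hlt]
  · obtain ⟨r, h⟩ := A.pref_witness hq
    exact ⟨r + 1, h⟩

/-- The items are pairs of landmarks, at most `k ^ 2` of them, and the values stay within `4 * ζ`,
so the phase is long enough. -/
theorem pref_complete {u v : Fin n} {e d r : ℕ} (he : e ∈ A.off u) (hd : d ∈ A.along u)
    (h1 : e / S ^ 8 ≤ ζ) (h2 : d / S ^ 8 ≤ ζ) (hr : HasWalk A.step (r + 1) u v) (h3 : r + 1 ≤ ζ) :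
    ∃ q ∈ A.pref v, q % S ^ 8 = Nat.pair (e % S ^ 8) (d % S ^ 8) ∧
      q / S ^ 8 ≤ e / S ^ 8 + 2 * (d / S ^ 8) + (r + 1) := by
  have hlt := A.pair_mod_lt he hd
  have hsub : Flood.items (S ^ 8) (fun v => prefixCodes (S ^ 8) ζ (A.off v) (A.along v)) ⊆
      (fun z : Fin n × Fin n => Nat.pair (I.ident z.1) (I.ident z.2)) ''
        (A.landmarks ×ˢ A.landmarks) := by
    rintro y ⟨u, w, ⟨e, he, d, hd, -, -, rfl⟩, rfl⟩
    have hlt := A.pair_mod_lt he hd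
    obtain ⟨x, hx, hx', -⟩ := A.off_sound he
    obtain ⟨y, hy, hy', -⟩ := A.along_sound hd
    refine ⟨(x, y), ⟨hx, hy⟩, ?_⟩
    rw [Nat.mul_add_mod_self_right, Nat.mod_eq_of_lt hlt, hx', hy']
  have hfin := (Set.toFinite (A.landmarks ×ˢ A.landmarks)).image
    (fun z : Fin n × Fin n => Nat.pair (I.ident z.1) (I.ident z.2))
  have hcard : (Flood.items (S ^ 8)
      (fun v => prefixCodes (S ^ 8) ζ (A.off v) (A.along v))).ncard ≤ k ^ 2 := by
    refine (Set.ncard_le_ncard hsub hfin).trans ((Set.ncard_image_le (Set.toFinite _)).trans ?_)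
    rw [Set.ncard_prod, sq]
    exact Nat.mul_le_mul A.card_le A.card_le
  have hlen := A.le_len
  set x := e / S ^ 8 + 2 * (d / S ^ 8) with hx
  have hw : x * S ^ 8 + Nat.pair (e % S ^ 8) (d % S ^ 8) + (r + 1) * S ^ 8 =
      (x + (r + 1)) * S ^ 8 + Nat.pair (e % S ^ 8) (d % S ^ 8) := by ring
  have hdiv : (x * S ^ 8 + Nat.pair (e % S ^ 8) (d % S ^ 8) + (r + 1) * S ^ 8) / S ^ 8 =
      x + (r + 1) := by
    rw [hw, mul_comm, Nat.mul_add_div A.pow_pos, Nat.div_eq_of_lt hlt, add_zero]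
  have hbound : x * S ^ 8 + Nat.pair (e % S ^ 8) (d % S ^ 8) + (r + 1) * S ^ 8 <
      (len + 1) * S ^ 8 := by
    have : (x + (r + 1) + 1) * S ^ 8 ≤ (len + 1) * S ^ 8 := Nat.mul_le_mul_right _ (by omega)
    linarith
  obtain ⟨m, hm, hle, hmod⟩ := Flood.state_complete (L := 2 ^ B)
    (H := edges I fun v => (A.inp v).pathOut)
    (W := fun v => prefixCodes (S ^ 8) ζ (A.off v) (A.along v)) A.pow_pos (hfin.subset hsub) hcard
    (hr.mono fun u w => (A.edges_path u w).2) ⟨e, he, d, hd, h1, h2, rfl⟩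
    (hbound.trans_le A.len_le) (t := len + 1) (by rw [hdiv]; omega)
  refine ⟨m, hm, ?_, (Nat.div_le_div_right hle).trans hdiv.le⟩
  rw [hmod, Nat.mul_add_mod_self_right, Nat.mod_eq_of_lt hlt]

end LineSetting

/-! ### Broadcasting the facts -/

namespace LineSetting

open Program

variable {n : ℕ} {I : RPathsInstance n} {B S ζ K k len : ℕ} (A : LineSetting I B S ζ K k len)

theorem own_eq (v : Fin n) :
    A.own v = ownFacts (S ^ 8) ζ (A.inp v) (A.off v) (A.along v) (A.allPref v) := rfl

theorem values_off_source {v : Fin n} {x r : ℕ} (h : r ∈ values (S ^ 8) (A.off v) x) :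
    ∃ y ∈ A.landmarks, x = I.ident y := by
  obtain ⟨e, he, rfl, -⟩ := h
  obtain ⟨y, hy, hy', -⟩ := A.off_sound he
  exact ⟨y, hy, hy'⟩

theorem values_along_source {v : Fin n} {x r : ℕ} (h : r ∈ values (S ^ 8) (A.along v) x) :
    ∃ y ∈ A.landmarks, x = I.ident y := by
  obtain ⟨e, he, rfl, -⟩ := h
  obtain ⟨y, hy, hy', -⟩ := A.along_sound he
  exact ⟨y, hy, hy'⟩

theorem relativeCosts_source {v : Fin n} {x r : ℕ}
    (h : r ∈ relativeCosts (S ^ 8) ζ (A.along v) (A.allPref v) x) :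
    ∃ y ∈ A.landmarks, x = I.ident y := by
  obtain ⟨q, hq, d, hd, -, hpair, -⟩ := h
  obtain ⟨r, u, e, d', he, hd', -, -, -, hq', -⟩ := A.allPref_witness hq
  rw [hq', Nat.pair_eq_pair] at hpair
  obtain ⟨y, hy, hy', -⟩ := A.off_sound he
  exact ⟨y, hy, hpair.1 ▸ hy'⟩

/-- The facts of one of the kinds about pairs of landmarks. -/
def pairFacts (kind : ℕ) (f : Fin n → ℕ → Set ℕ) : Set ℕ :=
  (fun z : Fin n × Fin n => fact kind (I.ident z.1) (I.ident z.2) (sInf (f z.1 (I.ident z.2)))) ''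
    (A.landmarks ×ˢ A.landmarks)

theorem pairFacts_finite (kind : ℕ) (f : Fin n → ℕ → Set ℕ) : (A.pairFacts kind f).Finite :=
  (Set.toFinite _).image _

theorem pairFacts_ncard_le (kind : ℕ) (f : Fin n → ℕ → Set ℕ) :
    (A.pairFacts kind f).ncard ≤ k ^ 2 := by
  refine (Set.ncard_image_le (Set.toFinite _)).trans ?_
  rw [Set.ncard_prod, sq]
  exact Nat.mul_le_mul A.card_le A.card_le

/-- The fact that identifies the first vertex of the path. -/
def startFacts : Set ℕ := {m | ∃ v, A.p.head? = some v ∧ m = fact 2 (I.ident v) 0 0}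

theorem startFacts_subsingleton : A.startFacts.Subsingleton := by
  rintro _ ⟨u, hu, rfl⟩ _ ⟨v, hv, rfl⟩
  rw [hu] at hv
  rw [Option.some.inj hv]

/-- Since only least values are announced, the kind and the pair of landmarks determine a fact. This
bounds the broadcast by `3 * k ^ 2 + 1` items. -/
theorem own_subset (v : Fin n) : A.own v ⊆
    A.pairFacts 0 (fun v x => values (S ^ 8) (A.off v) x) ∪
    A.pairFacts 1 (fun v x => values (S ^ 8) (A.along v) x) ∪ A.startFacts ∪
    A.pairFacts 3 (fun v x => relativeCosts (S ^ 8) ζ (A.along v) (A.allPref v) x) := by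
  rw [own_eq]
  rintro m (⟨hv, x, r, hr, -, rfl⟩ | ⟨hv, x, r, hr, -, rfl⟩ | ⟨hv, rfl⟩ | ⟨hv, x, r, hr, -, rfl⟩)
  · obtain ⟨y, hy, rfl⟩ := A.values_off_source hr.1
    refine Or.inl (Or.inl (Or.inl ⟨(v, y), ⟨(A.landmark_iff v).1 hv, hy⟩, ?_⟩))
    simp only [hr.csInf_eq, A.ident_eq]
  · obtain ⟨y, hy, rfl⟩ := A.values_along_source hr.1
    refine Or.inl (Or.inl (Or.inr ⟨(v, y), ⟨(A.landmark_iff v).1 hv, hy⟩, ?_⟩))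
    simp only [hr.csInf_eq, A.ident_eq]
  · exact Or.inl (Or.inr ⟨v, (A.start_iff v).1 hv, by rw [A.ident_eq]⟩)
  · obtain ⟨y, hy, rfl⟩ := A.relativeCosts_source hr.1
    refine Or.inr ⟨(v, y), ⟨(A.landmark_iff v).1 hv, hy⟩, ?_⟩
    simp only [hr.csInf_eq, A.ident_eq]

theorem own_lt {v : Fin n} {m : ℕ} (hm : m ∈ A.own v) : m < S ^ 8 := by
  have h4 := A.four_le
  have hζ := A.zeta_lt
  have hv : (A.inp v).ident < S := (A.ident_eq v).symm ▸ A.ident_lt v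
  rcases hm with ⟨-, x, r, hr, hle, rfl⟩ | ⟨-, x, r, hr, hle, rfl⟩ | ⟨-, rfl⟩ | ⟨-, x, r, hr, hle, rfl⟩
  · obtain ⟨y, -, rfl⟩ := A.values_off_source hr.1
    exact fact_lt (by omega) hv (A.ident_lt y) (by omega)
  · obtain ⟨y, -, rfl⟩ := A.values_along_source hr.1
    exact fact_lt (by omega) hv (A.ident_lt y) (by omega)
  · exact fact_lt (by omega) hv (by omega) (by omega)
  · obtain ⟨y, -, rfl⟩ := A.relativeCosts_source hr.1
    exact fact_lt (by omega) hv (A.ident_lt y) (by omega)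

theorem items_own_subset : Flood.items (S ^ 8) A.own ⊆
    A.pairFacts 0 (fun v x => values (S ^ 8) (A.off v) x) ∪
    A.pairFacts 1 (fun v x => values (S ^ 8) (A.along v) x) ∪ A.startFacts ∪
    A.pairFacts 3 (fun v x => relativeCosts (S ^ 8) ζ (A.along v) (A.allPref v) x) := by
  rintro m ⟨u, w, hw, rfl⟩
  rw [Nat.mod_eq_of_lt (A.own_lt hw)]
  exact A.own_subset u hw

theorem items_own_finite : (Flood.items (S ^ 8) A.own).Finite :=
  ((((A.pairFacts_finite _ _).union (A.pairFacts_finite _ _)).union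
    A.startFacts_subsingleton.finite).union (A.pairFacts_finite _ _)).subset A.items_own_subset

theorem items_own_ncard_le : (Flood.items (S ^ 8) A.own).ncard ≤ 3 * k ^ 2 + 1 := by
  have hfin := ((((A.pairFacts_finite 0 fun v x => values (S ^ 8) (A.off v) x).union
    (A.pairFacts_finite 1 fun v x => values (S ^ 8) (A.along v) x)).union
    A.startFacts_subsingleton.finite).union
    (A.pairFacts_finite 3 fun v x => relativeCosts (S ^ 8) ζ (A.along v) (A.allPref v) x))
  refine (Set.ncard_le_ncard A.items_own_subset hfin).trans ?_
  have h0 := A.pairFacts_ncard_le 0 (fun v x => values (S ^ 8) (A.off v) x)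
  have h1 := A.pairFacts_ncard_le 1 (fun v x => values (S ^ 8) (A.along v) x)
  have : Finite A.startFacts := A.startFacts_subsingleton.finite
  have h2 : A.startFacts.ncard ≤ 1 := Set.ncard_le_one_iff_subsingleton.2 A.startFacts_subsingleton
  have h3 := A.pairFacts_ncard_le 3
    (fun v x => relativeCosts (S ^ 8) ζ (A.along v) (A.allPref v) x)
  refine (Set.ncard_union_le _ _).trans ?_
  refine (Nat.add_le_add_right ((Set.ncard_union_le _ _).trans
    (Nat.add_le_add_right (Set.ncard_union_le _ _) _)) _).trans ?_
  omega

/-- After the broadcast all vertices know all facts. -/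
theorem mem_facts {v : Fin n} {m : ℕ} : m ∈ A.facts v ↔ ∃ u, m ∈ A.own u := by
  have hG : I.network.Connected := I.connected
  constructor
  · rintro ⟨m, hm, rfl⟩
    obtain ⟨u, r, w, -, hw, rfl⟩ := Flood.known_subset_reachable _ v hm
    refine ⟨u, ?_⟩
    -- Facts are codes of value zero, so reduction modulo `S ^ 8` removes the travelled distance.
    change (w + r * S ^ 8) % S ^ 8 ∈ A.own u
    rwa [Nat.add_mul_mod_self_right, Nat.mod_eq_of_lt (A.own_lt hw)]
  · rintro ⟨u, hu⟩
    have hlt := A.own_lt hu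
    by_cases huv : u = v
    · exact ⟨m, Or.inl (huv ▸ hu), Nat.mod_eq_of_lt hlt⟩
    have hpos := hG.pos_dist_of_ne huv
    obtain ⟨r, hr⟩ : ∃ r, I.network.dist u v = r + 1 := ⟨_, (Nat.sub_add_cancel hpos).symm⟩
    have hw := hasWalk_dist hG u v
    have hdist := A.dist_le u v
    have hlen := A.le_len
    rw [hr] at hw hdist
    have hdiv : (m + (r + 1) * S ^ 8) / S ^ 8 = r + 1 := by
      rw [Nat.add_mul_div_right _ _ A.pow_pos, Nat.div_eq_of_lt hlt, zero_add]
    have hbound : (m + (r + 1) * S ^ 8) < (len + 1) * S ^ 8 := by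
      have : (r + 2) * S ^ 8 ≤ (len + 1) * S ^ 8 := Nat.mul_le_mul_right _ (by omega)
      linarith
    obtain ⟨m', hm', -, hmod⟩ := Flood.state_complete (L := 2 ^ B)
      (H := edges I fun _ => Set.univ) A.pow_pos A.items_own_finite A.items_own_ncard_le
      (by rw [edges_univ]; exact hw) hu (hbound.trans_le A.len_le) (t := len + 1)
      (by rw [hdiv]; omega)
    exact ⟨m', Or.inr hm', hmod.trans (Nat.mod_eq_of_lt hlt)⟩

end LineSetting

/-! ## Positions on a path -/

theorem mem_pathEdges_iff {V : Type} {p : List V} {u v : V} :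
    (u, v) ∈ pathEdges p ↔ ∃ i : ℕ, p[i]? = some u ∧ p[i + 1]? = some v := by
  change (u, v) ∈ p.zip p.tail ↔ _
  rw [List.mem_iff_getElem?]
  simp [List.getElem?_zip_eq_some]

section PathWalks

variable {V : Type} {p : List V}

theorem getElem?_of_pathWalk (hp : p.Nodup) {r j : ℕ} {u v : V}
    (h : HasWalk (fun u v => (u, v) ∈ pathEdges p) r u v) (hu : p[j]? = some u) :
    p[j + r]? = some v := by
  induction r generalizing v with
  | zero => obtain rfl : u = v := h; exact hu
  | succ r ih =>
    obtain ⟨w, hw, hwv⟩ := h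
    obtain ⟨i, hi, hi'⟩ := mem_pathEdges_iff.1 hwv
    have hj := ih hw
    obtain rfl : i = j + r :=
      (List.getElem?_inj (List.getElem?_eq_some_iff.1 hi).1 hp).1 (hi.trans hj.symm)
    exact hi'

theorem exists_getElem?_of_pathWalk (hp : p.Nodup) {r i : ℕ} {u v : V}
    (h : HasWalk (fun u v => (u, v) ∈ pathEdges p) r u v) (hv : p[i]? = some v) :
    ∃ j, j + r = i ∧ p[j]? = some u := by
  induction r generalizing v i with
  | zero => obtain rfl : u = v := h; exact ⟨i, rfl, hv⟩
  | succ r ih =>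
    obtain ⟨w, hw, hwv⟩ := h
    obtain ⟨a, ha, ha'⟩ := mem_pathEdges_iff.1 hwv
    obtain rfl : a + 1 = i :=
      (List.getElem?_inj (List.getElem?_eq_some_iff.1 ha').1 hp).1 (ha'.trans hv.symm)
    obtain ⟨j, rfl, hj⟩ := ih hw ha
    exact ⟨j, rfl, hj⟩

theorem pathWalk_of_getElem? {r j : ℕ} {u v : V} (hu : p[j]? = some u) (hv : p[j + r]? = some v) :
    HasWalk (fun u v => (u, v) ∈ pathEdges p) r u v := by
  induction r generalizing v with
  | zero => exact Option.some.inj (hu.symm.trans hv)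
  | succ r ih =>
    have hlt : j + r < p.length := by
      have := (List.getElem?_eq_some_iff.1 hv).1
      omega
    exact ⟨p[j + r], ih (List.getElem?_eq_getElem hlt),
      mem_pathEdges_iff.2 ⟨j + r, List.getElem?_eq_getElem hlt, hv⟩⟩

end PathWalks

/-! ## What the vertices conclude -/

/-- The facts imply that the vertex with identifier `β` is at position `q` of the path. -/
inductive Position (F : Set ℕ) : ℕ → ℕ → Prop
  | start {β : ℕ} : fact 2 β 0 0 ∈ F → Position F β 0
  | step {β β' q δ : ℕ} : Position F β q → fact 1 β' β δ ∈ F → Position F β' (q + δ)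

/-- The facts imply that there is a walk with `r` steps off the path between two landmarks. -/
inductive Chain (F : Set ℕ) : ℕ → ℕ → ℕ → Prop
  | refl (α : ℕ) : Chain F α α 0
  | step {α β γ r q : ℕ} : fact 0 α β r ∈ F → Chain F β γ q → Chain F α γ (r + q)

/-- The costs of following the path and a detour up to the landmark with identifier `x`, as far as
they are known to a vertex with the codes `D` and `Q` and the facts `F`. -/
def costs (N ζ : ℕ) (D Q F : Set ℕ) (x : ℕ) : Set ℕ :=
  {c | (∃ q ∈ Q, ∃ d ∈ D, ∃ a, Position F (d % N) a ∧ d / N ≤ ζ ∧ q % N = Nat.pair x (d % N) ∧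
      c + d / N = q / N + a) ∨
    -- The vertex finds its own position `a + d / N` from a landmark behind it and accepts only
    -- minima announced at a strictly earlier position `b`.
    ∃ β ρ b, fact 3 β x ρ ∈ F ∧ Position F β b ∧ c + 2 * ζ = ρ + b ∧
      ∃ d ∈ D, ∃ a, Position F (d % N) a ∧ b < a + d / N}

namespace LineSetting

variable {n : ℕ} {I : RPathsInstance n} {B S ζ K k len : ℕ} (A : LineSetting I B S ζ K k len)

theorem fact_zero_mem {v u : Fin n} {α β r : ℕ} (h : fact 0 α β r ∈ A.facts v)
    (hα : α = I.ident u) : ∃ x ∈ A.landmarks, β = I.ident x ∧ HasWalk A.H r u x := by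
  obtain ⟨w, hw⟩ := A.mem_facts.1 h
  rcases hw with ⟨hl, x, r', hr, hle, heq⟩ | ⟨-, x, r', -, -, heq⟩ | ⟨-, heq⟩ |
    ⟨-, x, r', -, -, heq⟩ <;>
    rw [fact_inj] at heq
  · obtain ⟨-, h1, rfl, rfl⟩ := heq
    rw [A.ident_eq, hα] at h1
    obtain rfl := I.ident_injective h1
    obtain ⟨e, he, rfl, rfl⟩ := hr.1
    exact A.off_sound he
  all_goals omega

theorem fact_one_mem {v u : Fin n} {α β r : ℕ} (h : fact 1 α β r ∈ A.facts v)
    (hβ : β = I.ident u) : ∃ x ∈ A.landmarks, α = I.ident x ∧ HasWalk A.step r u x := by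
  obtain ⟨w, hw⟩ := A.mem_facts.1 h
  rcases hw with ⟨-, x, r', -, -, heq⟩ | ⟨hl, x, r', hr, hle, heq⟩ | ⟨-, heq⟩ |
    ⟨-, x, r', -, -, heq⟩ <;>
    rw [fact_inj] at heq
  · omega
  · obtain ⟨-, rfl, rfl, rfl⟩ := heq
    obtain ⟨e, he, h2, rfl⟩ := hr.1
    obtain ⟨y, hy, hy', hwalk⟩ := A.along_sound he
    obtain rfl := I.ident_injective (hβ.symm.trans (h2.symm.trans hy'))
    exact ⟨w, (A.landmark_iff w).1 hl, A.ident_eq w, hwalk⟩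
  all_goals omega

theorem fact_two_mem {v : Fin n} {α a b : ℕ} (h : fact 2 α a b ∈ A.facts v) :
    ∃ u, A.p[0]? = some u ∧ α = I.ident u := by
  obtain ⟨w, hw⟩ := A.mem_facts.1 h
  rcases hw with ⟨-, x, r', -, -, heq⟩ | ⟨-, x, r', -, -, heq⟩ | ⟨hs, heq⟩ |
    ⟨-, x, r', -, -, heq⟩ <;>
    rw [fact_inj] at heq
  any_goals omega
  refine ⟨w, ?_, heq.2.1.trans (A.ident_eq w)⟩
  rw [← List.head?_eq_getElem?]
  exact (A.start_iff w).1 hs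

theorem fact_three_mem {v u : Fin n} {α x r : ℕ} (h : fact 3 α x r ∈ A.facts v)
    (hα : α = I.ident u) :
    r ∈ relativeCosts (S ^ 8) ζ (A.along u) (A.allPref u) x := by
  obtain ⟨w, hw⟩ := A.mem_facts.1 h
  rcases hw with ⟨-, x, r', -, -, heq⟩ | ⟨-, x, r', -, -, heq⟩ | ⟨-, heq⟩ |
    ⟨hl, x, r', hr, hle, heq⟩ <;>
    rw [fact_inj] at heq
  any_goals omega
  obtain ⟨-, h1, rfl, rfl⟩ := heq
  rw [A.ident_eq, hα] at h1
  obtain rfl := I.ident_injective h1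
  exact hr.1

theorem position_sound {v : Fin n} {β q : ℕ} (h : Position (A.facts v) β q) :
    ∃ u, A.p[q]? = some u ∧ β = I.ident u := by
  induction h with
  | start h => exact A.fact_two_mem h
  | step _ h ih =>
    obtain ⟨u, hu, rfl⟩ := ih
    obtain ⟨x, -, rfl, hwalk⟩ := A.fact_one_mem h rfl
    exact ⟨x, getElem?_of_pathWalk A.nodup hwalk hu, rfl⟩

theorem position_at {v u : Fin n} {β q a : ℕ} (h : Position (A.facts v) β q)
    (hu : A.p[a]? = some u) (hβ : β = I.ident u) : q = a := by
  obtain ⟨w, hw, hw'⟩ := A.position_sound h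
  obtain rfl := I.ident_injective (hβ.symm.trans hw')
  exact (List.getElem?_inj (List.getElem?_eq_some_iff.1 hw).1 A.nodup).1 (hw.trans hu.symm)

theorem chain_sound {v : Fin n} {α γ r : ℕ} (h : Chain (A.facts v) α γ r) {u : Fin n}
    (hα : α = I.ident u) : ∃ x, γ = I.ident x ∧ HasWalk A.H r u x := by
  induction h generalizing u with
  | refl α => exact ⟨u, hα, rfl⟩
  | step h _ ih =>
    obtain ⟨x, -, hx, hwalk⟩ := A.fact_zero_mem h hα
    obtain ⟨y, hy, hwalk'⟩ := ih hx
    exact ⟨y, hy, hwalk.trans hwalk'⟩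

/-- A code of the pipelined minimum at position `i` stands for a detour that begins at position
`i - r`. -/
theorem witness_sound {v : Fin n} {i q r x d : ℕ} (hv : A.p[i]? = some v)
    (hq : A.Witness v q r) (hd : d ∈ A.along v) (hpair : q % S ^ 8 = Nat.pair x (d % S ^ 8)) :
    ∃ y ∈ A.landmarks, x = I.ident y ∧ ∃ j u m b w, j + r = i ∧ A.p[j]? = some u ∧
      HasWalk A.H m u y ∧ b + d / S ^ 8 = i ∧ b ≤ j ∧ A.p[b]? = some w ∧
      d % S ^ 8 = I.ident w ∧ q / S ^ 8 + r = m + 2 * (d / S ^ 8) := by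
  obtain ⟨u, e, d', he, hd', -, -, hwalk, hq', hval⟩ := hq
  rw [hq', Nat.pair_eq_pair] at hpair
  obtain ⟨y, hy, hy', hyw⟩ := A.off_sound he
  obtain ⟨z, -, hz, hzw⟩ := A.along_sound hd
  obtain ⟨z', -, hz', hzw'⟩ := A.along_sound hd'
  obtain rfl : z = z' := I.ident_injective (hz.symm.trans (hpair.2.symm.trans hz'))
  obtain ⟨j, hj, hju⟩ := exists_getElem?_of_pathWalk A.nodup hwalk hv
  obtain ⟨b, hb, hbz⟩ := exists_getElem?_of_pathWalk A.nodup hzw hv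
  obtain ⟨b', hb', hbz'⟩ := exists_getElem?_of_pathWalk A.nodup hzw' hju
  -- Both codes refer to the same occurrence of `z`, so the distance from `z` grows by exactly `r`
  -- between `u` and `v`.
  obtain rfl : b = b' :=
    (List.getElem?_inj (List.getElem?_eq_some_iff.1 hbz).1 A.nodup).1 (hbz.trans hbz'.symm)
  exact ⟨y, hy, hpair.1 ▸ hy', j, u, _, b, z, hj, hju, hyw, hb, by omega, hbz, hz, by omega⟩

/-- A cost that is derived from codes which stand for detours that begin at least `s ≤ 1` steps
earlier belongs to a walk off the path from an earlier vertex to a landmark. -/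
theorem costs_sound {v : Fin n} {i s x c : ℕ} (hs : s ≤ 1) (hv : A.p[i]? = some v) {Q : Set ℕ}
    (hQ : ∀ q ∈ Q, ∃ r, s ≤ r ∧ A.Witness v q r)
    (hc : c ∈ costs (S ^ 8) ζ (A.along v) Q (A.facts v) x) :
    ∃ y ∈ A.landmarks, x = I.ident y ∧ ∃ j u m, j + s ≤ i ∧ A.p[j]? = some u ∧
      HasWalk A.H m u y ∧ c = j + m := by
  rcases hc with ⟨q, hq, d, hd, a, ha, -, hpair, hc⟩ | ⟨β, ρ, b, hfact, hb, hc, d, hd, a, ha, hlt⟩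
  · obtain ⟨r, hr, hw⟩ := hQ q hq
    obtain ⟨y, hy, hx, j, u, m, b, w, hj, hu, hwalk, hb, hbj, hbw, hdw, hval⟩ :=
      A.witness_sound hv hw hd hpair
    have := A.position_at ha hbw hdw
    exact ⟨y, hy, hx, j, u, m, by omega, hu, hwalk, by omega⟩
  -- The announcing landmark may be the start of the detour itself; `b < i` supplies the one step
  -- needed when `s = 1`.
  · obtain ⟨z, -, hz, hzw⟩ := A.along_sound hd
    obtain ⟨a', ha', haz⟩ := exists_getElem?_of_pathWalk A.nodup hzw hv
    have haa := A.position_at ha haz hz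
    obtain ⟨u', hu', hβ⟩ := A.position_sound hb
    obtain ⟨q, hq, d', hd', -, hpair, hρ⟩ := A.fact_three_mem hfact hβ
    obtain ⟨r, hw⟩ := A.allPref_witness hq
    obtain ⟨y, hy, hx, j, u, m, b', w, hj, hu, hwalk, hb', hbj, hbw, hdw, hval⟩ :=
      A.witness_sound hu' hw hd' hpair
    exact ⟨y, hy, hx, j, u, m, by omega, hu, hwalk, by omega⟩

/-! ### Completeness of the facts and costs -/

theorem exists_isLeast {T : Set ℕ} {r : ℕ} (hr : r ∈ T) : ∃ r', IsLeast T r' ∧ r' ≤ r :=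
  ⟨sInf T, ⟨Nat.sInf_mem ⟨r, hr⟩, fun _ h => Nat.sInf_le h⟩, Nat.sInf_le hr⟩

theorem fact_zero_complete (v : Fin n) {u x : Fin n} (hu : u ∈ A.landmarks) (hx : x ∈ A.landmarks)
    {r : ℕ} (h : HasWalk A.H r u x) (hr : r ≤ ζ) :
    ∃ r' ≤ r, fact 0 (I.ident u) (I.ident x) r' ∈ A.facts v := by
  obtain ⟨e, he, h1, h2⟩ := A.off_complete hx h hr
  obtain ⟨r', hr', hle⟩ := exists_isLeast (T := values (S ^ 8) (A.off u) (I.ident x)) ⟨e, he, h1, rfl⟩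
  refine ⟨r', by omega, A.mem_facts.2 ⟨u, Or.inl ⟨(A.landmark_iff u).2 hu, _, r', hr', by omega, ?_⟩⟩⟩
  rw [A.ident_eq]

/-- Whether landmarks are dense enough on the path. -/
def Dense : Prop :=
  ∀ j, j + 1 < A.p.length → ∃ a b u w, a ≤ j ∧ j < b ∧ b ≤ a + ζ ∧ A.p[a]? = some u ∧
    A.p[b]? = some w ∧ u ∈ A.landmarks ∧ w ∈ A.landmarks

/-- A path visits each vertex once, so every walk along it between two given vertices has the same
length and every code is exact. -/
theorem along_value {v : Fin n} {d a i : ℕ} {u : Fin n} (hd : d ∈ A.along v)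
    (hv : A.p[i]? = some v) (hu : A.p[a]? = some u) (h : d % S ^ 8 = I.ident u) :
    a + d / S ^ 8 = i := by
  obtain ⟨z, -, hz, hzw⟩ := A.along_sound hd
  obtain rfl := I.ident_injective (h.symm.trans hz)
  have := getElem?_of_pathWalk A.nodup hzw hu
  exact (List.getElem?_inj (List.getElem?_eq_some_iff.1 this).1 A.nodup).1 (this.trans hv.symm)

theorem exists_along {v u : Fin n} {a i : ℕ} (hv : A.p[i]? = some v) (hu : A.p[a]? = some u)
    (hl : u ∈ A.landmarks) (hai : a ≤ i) (hζ : i ≤ a + ζ) :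
    ∃ d ∈ A.along v, d % S ^ 8 = I.ident u ∧ a + d / S ^ 8 = i := by
  have hwalk : HasWalk A.step (i - a) u v :=
    pathWalk_of_getElem? hu (by rwa [Nat.add_sub_cancel' hai])
  obtain ⟨d, hd, h1, -⟩ := A.along_complete hl hwalk (by omega)
  exact ⟨d, hd, h1, A.along_value hd hv hu h1⟩

/-- Density gives a landmark at most `ζ` steps earlier whose distance `u` has learnt and announced;
the induction descends to the first vertex, which announces itself. -/
theorem position_complete (hA : A.Dense) (v : Fin n) {a : ℕ} {u : Fin n} (hu : A.p[a]? = some u)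
    (hl : u ∈ A.landmarks) : Position (A.facts v) (I.ident u) a := by
  induction a using Nat.strong_induction_on generalizing u with
  | _ a ih =>
  cases a with
  | zero =>
    refine Position.start (A.mem_facts.2 ⟨u, Or.inr (Or.inr (Or.inl ⟨(A.start_iff u).2 ?_, ?_⟩))⟩)
    · rw [List.head?_eq_getElem?, hu]
    · rw [A.ident_eq]
  | succ a =>
    have hlen := (List.getElem?_eq_some_iff.1 hu).1
    obtain ⟨a', b, w, -, ha', hb, hbound, hw, -, hwl, -⟩ := hA a hlen
    obtain ⟨d, hd, h1, h2⟩ := A.exists_along hu hw hwl (by omega) (by omega)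
    have hpos := ih a' (by omega) hw hwl
    obtain ⟨r, hr, hle⟩ :=
      exists_isLeast (T := values (S ^ 8) (A.along u) (I.ident w)) ⟨d, hd, h1, rfl⟩
    obtain ⟨d', hd', h1', rfl⟩ := hr.1
    have h2' := A.along_value hd' hu hw h1'
    rw [← h2']
    refine Position.step hpos (A.mem_facts.2 ⟨u, Or.inr (Or.inl
      ⟨(A.landmark_iff u).2 hl, _, _, hr, by omega, ?_⟩)⟩)
    rw [A.ident_eq]

/-- A short walk off the path from an earlier vertex to a landmark contributes to the codes of the
pipelined minimum. -/
theorem exists_allPref {v u w y : Fin n} {a i j m : ℕ} (hv : A.p[i]? = some v)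
    (hu : A.p[j]? = some u) (hw : A.p[a]? = some w) (hwl : w ∈ A.landmarks) (haj : a ≤ j)
    (hji : j ≤ i) (hζ : i ≤ a + ζ) (hy : y ∈ A.landmarks) (hm : m ≤ ζ) (hwalk : HasWalk A.H m u y) :
    ∃ q ∈ A.allPref v, (j < i → q ∈ A.pref v) ∧ q % S ^ 8 = Nat.pair (I.ident y) (I.ident w) ∧
      q / S ^ 8 ≤ m + 2 * (j - a) + (i - j) := by
  obtain ⟨e, he, he1, he2⟩ := A.off_complete hy hwalk hm
  obtain ⟨d, hd, hd1, hd2⟩ := A.exists_along hu hw hwl haj (by omega)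
  rcases hji.eq_or_lt with rfl | hlt
  · obtain rfl : u = v := Option.some.inj (hu.symm.trans hv)
    have hlt := A.pair_mod_lt he hd
    refine ⟨_, Or.inl ⟨e, he, d, hd, by omega, by omega, rfl⟩, fun h => absurd h (lt_irrefl _), ?_, ?_⟩
    · rw [Nat.mul_add_mod_self_right, Nat.mod_eq_of_lt hlt, he1, hd1]
    · rw [mul_comm, Nat.mul_add_div A.pow_pos, Nat.div_eq_of_lt hlt]
      omega
  · obtain ⟨r, hr⟩ : ∃ r, i = j + (r + 1) := ⟨i - j - 1, by omega⟩
    obtain ⟨q, hq, hq1, hq2⟩ := A.pref_complete he hd (by omega) (by omega)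
      (pathWalk_of_getElem? hu (hr ▸ hv)) (by omega)
    exact ⟨q, Or.inr hq, fun _ => hq, by rw [hq1, he1, hd1], by omega⟩

/-- Density encloses the start of the detour: `a ≤ j < b ≤ a + ζ` with landmarks at `a` and `b`. If
`b < i`, the landmark at `b` has announced a minimum that takes this start into account; otherwise
`v` is within `ζ` of `a` and has the codes itself. -/
theorem costs_complete (hA : A.Dense) {v u y : Fin n} {i j m : ℕ} (hv : A.p[i]? = some v)
    (hu : A.p[j]? = some u) (hji : j ≤ i) (hj : j + 1 < A.p.length) (hy : y ∈ A.landmarks)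
    (hm : m ≤ ζ) (hwalk : HasWalk A.H m u y) {Q : Set ℕ}
    (hQ : Q = A.allPref v ∨ Q = A.pref v ∧ j < i) :
    ∃ c ∈ costs (S ^ 8) ζ (A.along v) Q (A.facts v) (I.ident y), c ≤ j + m := by
  obtain ⟨a, b, w, w', haj, hjb, hba, hw, hw', hwl, hwl'⟩ := hA j hj
  have hpos := A.position_complete hA v hw hwl
  by_cases hbi : b < i
  · obtain ⟨q, hq, -, hq1, hq2⟩ :=
      A.exists_allPref hw' hu hw hwl haj hjb.le hba hy hm hwalk
    obtain ⟨d, hd, hd1, hd2⟩ := A.exists_along hw' hw hwl (by omega) hba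
    have hqw : 2 * (d / S ^ 8) ≤ q / S ^ 8 + 2 * ζ :=
      le_add_left (Nat.mul_le_mul_left 2 (by omega))
    have hρ : q / S ^ 8 + 2 * ζ - 2 * (d / S ^ 8) ∈
        relativeCosts (S ^ 8) ζ (A.along w') (A.allPref w') (I.ident y) :=
      ⟨q, hq, d, hd, by omega, by rw [hq1, hd1], by omega⟩
    obtain ⟨ρ, hleast, hle⟩ := exists_isLeast hρ
    have hfact : fact 3 (I.ident w') (I.ident y) ρ ∈ A.facts v := by
      refine A.mem_facts.2 ⟨w', Or.inr (Or.inr (Or.inr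
        ⟨(A.landmark_iff w').2 hwl', _, ρ, hleast, by omega, ?_⟩))⟩
      rw [A.ident_eq]
    have hpos' := A.position_complete hA v hw' hwl'
    -- The least relative cost comes from a genuine start, so the natural subtraction below is
    -- exact.
    have hge : 2 * ζ ≤ ρ + b := by
      obtain ⟨q', hq', d', hd', -, hpair, hρ'⟩ := hleast.1
      obtain ⟨r', hr'⟩ := A.allPref_witness hq'
      obtain ⟨_, _, _, _, _, _, _, _, _, _, _, _, _, _, _, _⟩ :=
        A.witness_sound hw' hr' hd' hpair
      omega
    -- Density at the step into `v` yields the landmark from which `v` derives its position.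
    obtain ⟨i', b', z, z', hi', hib', hbi', hz, -, hzl, -⟩ := hA (i - 1) (by
      have := (List.getElem?_eq_some_iff.1 hv).1
      omega)
    obtain ⟨d', hd', hd1', hd2'⟩ := A.exists_along hv hz hzl (by omega) (by omega)
    refine ⟨ρ + b - 2 * ζ, Or.inr ⟨I.ident w', ρ, b, hfact, hpos', by omega, d', hd', i', ?_,
      by omega⟩, by omega⟩
    rw [hd1']
    exact A.position_complete hA v hz hzl
  · obtain ⟨q, hq, hq', hq1, hq2⟩ :=
      A.exists_allPref hv hu hw hwl haj hji (by omega) hy hm hwalk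
    obtain ⟨d, hd, hd1, hd2⟩ := A.exists_along hv hw hwl (by omega) (by omega)
    have hqQ : q ∈ Q := by
      rcases hQ with rfl | ⟨rfl, h⟩
      exacts [hq, hq' h]
    have hge : d / S ^ 8 ≤ q / S ^ 8 + a := by
      obtain ⟨r, hr⟩ := A.allPref_witness hq
      obtain ⟨_, _, _, _, _, _, _, _, _, _, _, _, _, _, _, _⟩ :=
        A.witness_sound hv hr hd (by rw [hq1, hd1])
      omega
    exact ⟨q / S ^ 8 + a - d / S ^ 8, Or.inl ⟨q, hqQ, d, hd, a, by rw [hd1]; exact hpos, by omega,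
      by rw [hq1, hd1], by omega⟩, by omega⟩

end LineSetting

/-! ## Walks and paths -/

theorem hasWalk_of_forall_getElem? {V : Type} {H : V → V → Prop} {l : List V} {r j : ℕ} {u v : V}
    (h : ∀ a x y, j ≤ a → a < j + r → l[a]? = some x → l[a + 1]? = some y → H x y)
    (hu : l[j]? = some u) (hv : l[j + r]? = some v) : HasWalk H r u v := by
  induction r generalizing v with
  | zero => exact Option.some.inj (hu.symm.trans hv)
  | succ r ih =>
    have hlt : j + r < l.length := by
      have := (List.getElem?_eq_some_iff.1 hv).1
      omega
    have hw : l[j + r]? = some l[j + r] := List.getElem?_eq_getElem hlt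
    exact ⟨l[j + r], ih (fun a x y h1 h2 => h a x y h1 (by omega)) hw,
      h (j + r) _ _ (by omega) (by omega) hw hv⟩

theorem IsDiPath.adj_of_getElem? {V : Type} {H : Digraph V} {u v : V} {l : List V}
    (hl : IsDiPath H u v l) {a : ℕ} {x y : V} (hx : l[a]? = some x) (hy : l[a + 1]? = some y) :
    H.Adj x y := by
  obtain ⟨h1, rfl⟩ := List.getElem?_eq_some_iff.1 hx
  obtain ⟨h2, rfl⟩ := List.getElem?_eq_some_iff.1 hy
  exact List.isChain_iff_getElem.1 hl.chain a h2

theorem IsDiPath.ne_of_getElem? {V : Type} {H : Digraph V} {u v : V} {l : List V}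
    (hl : IsDiPath H u v l) {a : ℕ} {x y : V} (hx : l[a]? = some x) (hy : l[a + 1]? = some y) :
    x ≠ y := by
  rintro rfl
  have := (List.getElem?_inj (List.getElem?_eq_some_iff.1 hx).1 hl.nodup).1 (hx.trans hy.symm)
  omega

theorem IsDiPath.length_pos {V : Type} {H : Digraph V} {u v : V} {l : List V}
    (hl : IsDiPath H u v l) : 0 < l.length := by
  rw [List.length_pos_iff]
  rintro rfl
  simpa using hl.head

theorem IsDiPath.getElem?_zero {V : Type} {H : Digraph V} {u v : V} {l : List V}
    (hl : IsDiPath H u v l) : l[0]? = some u := by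
  rw [← List.head?_eq_getElem?, hl.head]

theorem IsDiPath.getElem?_pathLength {V : Type} {H : Digraph V} {u v : V} {l : List V}
    (hl : IsDiPath H u v l) : l[pathLength l]? = some v := by
  rw [pathLength, ← List.getLast?_eq_getElem?, hl.last]

/-- Loop erasure: when the next vertex has been visited already, the path is cut back to it. -/
theorem exists_isDiPath_of_hasWalk {V : Type} {H : Digraph V} {m : ℕ} {u v : V}
    (h : HasWalk H.Adj m u v) : ∃ l, IsDiPath H u v l ∧ pathLength l ≤ m := by
  classical
  induction m generalizing v with
  | zero =>
    obtain rfl : u = v := h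
    exact ⟨[u], ⟨by simp, by simp, rfl, rfl⟩, by simp [pathLength]⟩
  | succ m ih =>
    obtain ⟨w, hw, hwv⟩ := h
    obtain ⟨l, hl, hlen⟩ := ih hw
    have hpos := hl.length_pos
    by_cases hv : v ∈ l
    · obtain ⟨a, ha⟩ := List.mem_iff_getElem?.1 hv
      obtain ⟨ha', -⟩ := List.getElem?_eq_some_iff.1 ha
      refine ⟨l.take (a + 1), ⟨hl.chain.take _, hl.nodup.sublist (List.take_sublist _ _), ?_, ?_⟩, ?_⟩
      · rw [List.head?_take, if_neg (by omega), hl.head]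
      · rw [List.getLast?_eq_getElem?, List.length_take, min_eq_left (by omega),
          List.getElem?_take, if_pos (by omega)]
        exact ha
      · simp only [pathLength, List.length_take] at hlen ⊢
        omega
    · refine ⟨l ++ [v], ⟨?_, ?_, ?_, ?_⟩, ?_⟩
      · rw [List.isChain_append]
        refine ⟨hl.chain, by simp, ?_⟩
        intro x hx y hy
        rw [hl.last] at hx
        obtain rfl : w = x := by simpa using hx
        obtain rfl : v = y := by simpa using hy
        exact hwv
      · rw [List.nodup_append]
        refine ⟨hl.nodup, by simp, ?_⟩
        rintro x hx y hy rfl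
        exact hv (by simpa using (List.mem_singleton.1 hy) ▸ hx)
      · rw [List.head?_append, hl.head]
        rfl
      · simp
      · simp only [pathLength, List.length_append, List.length_singleton] at hlen ⊢
        omega

theorem diDist_le_of_hasWalk {V : Type} {H : Digraph V} {m : ℕ} {u v : V}
    (h : HasWalk H.Adj m u v) : diDist H u v ≤ m := by
  obtain ⟨l, hl, hlen⟩ := exists_isDiPath_of_hasWalk h
  exact (iInf₂_le l hl).trans (by exact_mod_cast hlen)

theorem mem_pathEdges_reverse {V : Type} {p : List V} {u v : V} :
    (u, v) ∈ pathEdges p.reverse ↔ (v, u) ∈ pathEdges p := by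
  have key : ∀ (p : List V) (u v : V), (u, v) ∈ pathEdges p → (v, u) ∈ pathEdges p.reverse := by
    intro p u v h
    obtain ⟨i, hi, hi'⟩ := mem_pathEdges_iff.1 h
    have hlt := (List.getElem?_eq_some_iff.1 hi').1
    refine mem_pathEdges_iff.2 ⟨p.length - 1 - (i + 1), ?_, ?_⟩
    · rw [List.getElem?_reverse (by omega), ← hi']
      congr 1
      omega
    · rw [List.getElem?_reverse (by omega), ← hi]
      congr 1
      omega
  refine ⟨fun h => ?_, key p v u⟩
  simpa using key _ _ _ h

/-! ## The complete program -/

namespace Program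

/-- The input of a vertex for the forward half. -/
def forwardInput (a : LocalInput) (landmark : Prop) : HalfInput where
  ident := a.ident
  offIn := a.inNbrs \ a.pathIn
  pathOut := a.pathOut
  isStart := a.isSource
  isLandmark := landmark ∨ a.isSource ∨ a.isTarget

/-- The input of a vertex for the backward half. -/
def backwardInput (a : LocalInput) (landmark : Prop) : HalfInput where
  ident := a.ident
  offIn := a.outNbrs \ a.pathOut
  pathOut := a.pathIn
  isStart := a.isTarget
  isLandmark := landmark ∨ a.isSource ∨ a.isTarget

/-- The lengths of the walks from the source to the target that a vertex can deduce. -/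
def totals (N ζ : ℕ) (r₁ r₂ : HalfResult) : Set ℕ :=
  {t | ∃ x y c c' r,
    -- A detour may leave the path at the vertex itself, so the forward half includes its own codes;
    -- it must rejoin strictly later, so the backward half uses received codes only.
    c ∈ costs N ζ r₁.along (prefixCodes N ζ r₁.off r₁.along ∪ r₁.pref) r₁.facts x ∧
    c' ∈ costs N ζ r₂.along r₂.pref r₂.facts y ∧ Chain r₁.facts x y r ∧ t = c + r + c'}

/-- The output of a vertex. -/
noncomputable def answer (N ζ : ℕ) (r₁ r₂ : HalfResult) : ℕ∞ := ⨅ t ∈ totals N ζ r₁ r₂, (t : ℕ∞)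

/-- The length of the phases of the main part. -/
def phaseLength (ζ k K : ℕ) : ℕ := 4 * ζ + 2 * K + 3 * k ^ 2 + 1

/-- The program of a vertex. -/
noncomputable def complete (n N ζ k : ℕ) (a : LocalInput) (landmark : Prop) : Program :=
  probe N (fun K =>
    half N ζ (phaseLength ζ k K) (forwardInput a landmark) fun r₁ =>
    half N ζ (phaseLength ζ k K) (backwardInput a landmark) fun r₂ =>
    halt (answer N ζ r₁ r₂)) a.isSource (n + 1) 1

end Program

/-! ### Edges off the path and good landmarks -/

namespace RPathsInstance

variable {n : ℕ} (I : RPathsInstance n)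

/-- The edges that are not on the path. -/
def offPath (u v : Fin n) : Prop := (removeEdges I.graph (pathEdges I.path)).Adj u v ∧ u ≠ v

theorem network_adj {u v : Fin n} :
    I.network.Adj u v ↔ u ≠ v ∧ (I.graph.Adj u v ∨ I.graph.Adj v u) := by
  simp [network, Digraph.toSimpleGraphInclusive]

theorem adj_of_mem_pathEdges {u v : Fin n} (h : (u, v) ∈ pathEdges I.path) :
    I.graph.Adj u v ∧ u ≠ v := by
  obtain ⟨i, hi, hi'⟩ := mem_pathEdges_iff.1 h
  exact ⟨I.path_isPath.adj_of_getElem? hi hi', I.path_isPath.ne_of_getElem? hi hi'⟩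

theorem exists_ident_iff {p : Fin n → Prop} {v : Fin n} :
    (∃ w, p w ∧ I.ident w = I.ident v) ↔ p v :=
  ⟨fun ⟨_, hw, h⟩ => I.ident_injective h ▸ hw, fun h => ⟨v, h, rfl⟩⟩

theorem mem_inNbrs {u v : Fin n} : I.ident v ∈ (I.localInput u).inNbrs ↔ I.graph.Adj v u :=
  I.exists_ident_iff

theorem mem_outNbrs {u v : Fin n} : I.ident v ∈ (I.localInput u).outNbrs ↔ I.graph.Adj u v :=
  I.exists_ident_iff

theorem mem_pathIn {u v : Fin n} :
    I.ident v ∈ (I.localInput u).pathIn ↔ (v, u) ∈ pathEdges I.path :=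
  I.exists_ident_iff

theorem mem_pathOut {u v : Fin n} :
    I.ident v ∈ (I.localInput u).pathOut ↔ (u, v) ∈ pathEdges I.path :=
  I.exists_ident_iff

/-- Every `ζ` consecutive vertices of `l` contain a landmark. -/
def Covered (L : Set (Fin n)) (ζ : ℕ) (l : List (Fin n)) : Prop :=
  ∀ a, a + ζ ≤ l.length → ∃ b, a ≤ b ∧ b < a + ζ ∧ ∃ u ∈ L, l[b]? = some u

/-- The landmarks are few and lie densely on the path and on suitable long detours. -/
structure GoodLandmarks (ζ k : ℕ) (L : Set (Fin n)) : Prop where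
  source_mem : I.s ∈ L
  target_mem : I.t ∈ L
  card_le : L.ncard ≤ k
  path_covered : Covered L ζ I.path
  -- Covering one no longer detour with the same ends is enough, which keeps the later union bound
  -- polynomial.
  detour_covered : ∀ u v d, IsDiPath (removeEdges I.graph (pathEdges I.path)) u v d →
    IsLongDetour n d → ∃ d', IsDiPath (removeEdges I.graph (pathEdges I.path)) u v d' ∧
      ζ ≤ d'.length ∧ pathLength d' ≤ pathLength d ∧ Covered L ζ d'

end RPathsInstance

/-! ### The two halves for an instance and the correctness of the output -/

namespace RPathsInstance

open Program

variable {n : ℕ} (I : RPathsInstance n)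

/-- What the identifiers and the lengths of the phases have to satisfy. -/
structure Suitable (B S ζ K k : ℕ) : Prop where
  ident_lt : ∀ v, I.ident v < S
  four_le : 4 ≤ S
  zeta_lt : 3 * ζ < S
  dist_le : ∀ u v, I.network.dist u v ≤ 2 * K
  len_le : (phaseLength ζ k K + 1) * S ^ 8 ≤ 2 ^ B

variable {I} {B S ζ K k : ℕ} {flag : Fin n → Prop}

/-- The landmarks: the vertices with a flag and the ends of the path. -/
def landmarks (I : RPathsInstance n) (flag : Fin n → Prop) : Set (Fin n) :=
  {v | flag v ∨ v = I.s ∨ v = I.t}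

/-- The setting of the forward half. -/
def forwardSetting (h : I.Suitable B S ζ K k) (hL : I.GoodLandmarks ζ k (I.landmarks flag)) :
    LineSetting I B S ζ K k (phaseLength ζ k K) where
  H := I.offPath
  p := I.path
  landmarks := I.landmarks flag
  inp v := forwardInput (I.localInput v) (flag v)
  nodup := I.path_isPath.nodup
  ident_eq _ := rfl
  edges_off u v := by
    change I.network.Adj v u ∧ (I.ident v ∈ (I.localInput u).inNbrs ∧
      I.ident v ∉ (I.localInput u).pathIn) ↔ _
    rw [mem_inNbrs, mem_pathIn, network_adj, offPath, removeEdges]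
    tauto
  edges_path u v := by
    change I.network.Adj v u ∧ I.ident v ∈ (I.localInput u).pathOut ↔ _
    rw [mem_pathOut, network_adj]
    have := I.adj_of_mem_pathEdges (u := u) (v := v)
    have := @Ne.symm _ u v
    tauto
  start_iff v := by
    rw [I.path_isPath.head]
    change v = I.s ↔ _
    rw [Option.some_inj, eq_comm]
  landmark_iff _ := Iff.rfl
  card_le := hL.card_le
  ident_lt := h.ident_lt
  four_le := h.four_le
  zeta_lt := h.zeta_lt
  dist_le := h.dist_le
  le_len := le_rfl
  len_le := h.len_le

/-- The setting of the backward half. -/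
def backwardSetting (h : I.Suitable B S ζ K k) (hL : I.GoodLandmarks ζ k (I.landmarks flag)) :
    LineSetting I B S ζ K k (phaseLength ζ k K) where
  H u v := I.offPath v u
  p := I.path.reverse
  landmarks := I.landmarks flag
  inp v := backwardInput (I.localInput v) (flag v)
  nodup := List.nodup_reverse.2 I.path_isPath.nodup
  ident_eq _ := rfl
  edges_off u v := by
    change I.network.Adj v u ∧ (I.ident v ∈ (I.localInput u).outNbrs ∧
      I.ident v ∉ (I.localInput u).pathOut) ↔ _
    rw [mem_outNbrs, mem_pathOut, network_adj, offPath, removeEdges]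
    have := @Ne.symm _ u v
    have := @Ne.symm _ v u
    tauto
  edges_path u v := by
    change I.network.Adj v u ∧ I.ident v ∈ (I.localInput u).pathIn ↔ _
    rw [mem_pathIn, network_adj, mem_pathEdges_reverse]
    have := I.adj_of_mem_pathEdges (u := v) (v := u)
    tauto
  start_iff v := by
    rw [List.head?_reverse, I.path_isPath.last]
    change v = I.t ↔ _
    rw [Option.some_inj, eq_comm]
  landmark_iff _ := Iff.rfl
  card_le := hL.card_le
  ident_lt := h.ident_lt
  four_le := h.four_le
  zeta_lt := h.zeta_lt
  dist_le := h.dist_le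
  le_len := le_rfl
  len_le := h.len_le

/-- Take the last landmark up to `j`, which exists because of `s`. The window just after it contains
the next one; if the path ends too early for that window, `t` serves. -/
theorem forwardSetting_dense (h : I.Suitable B S ζ K k)
    (hL : I.GoodLandmarks ζ k (I.landmarks flag)) : (forwardSetting h hL).Dense := by
  classical
  intro j hj
  change j + 1 < I.path.length at hj
  change ∃ a b u w, a ≤ j ∧ j < b ∧ b ≤ a + ζ ∧ I.path[a]? = some u ∧ I.path[b]? = some w ∧
    u ∈ I.landmarks flag ∧ w ∈ I.landmarks flag
  let P : ℕ → Prop := fun a => ∃ u ∈ I.landmarks flag, I.path[a]? = some u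
  have h0 : P 0 := ⟨I.s, hL.source_mem, I.path_isPath.getElem?_zero⟩
  have hspec : P (Nat.findGreatest P j) := Nat.findGreatest_spec (Nat.zero_le j) h0
  have hle := Nat.findGreatest_le (P := P) j
  set a := Nat.findGreatest P j with ha
  obtain ⟨u, hu, hau⟩ := hspec
  by_cases hcase : a + 1 + ζ ≤ I.path.length
  · obtain ⟨b, hb1, hb2, w, hw, hbw⟩ := hL.path_covered (a + 1) hcase
    refine ⟨a, b, u, w, hle, ?_, by omega, hau, hbw, hu, hw⟩
    by_contra! hbj
    have := Nat.le_findGreatest (P := P) hbj ⟨w, hw, hbw⟩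
    omega
  · refine ⟨a, I.path.length - 1, u, I.t, hle, by omega, by omega, hau,
      I.path_isPath.getElem?_pathLength, hu, hL.target_mem⟩

/-- Step `j` of the reversed path is step `length - 2 - j` of the path, and the enclosing landmarks
exchange roles. -/
theorem backwardSetting_dense (h : I.Suitable B S ζ K k)
    (hL : I.GoodLandmarks ζ k (I.landmarks flag)) : (backwardSetting h hL).Dense := by
  intro j hj
  change j + 1 < I.path.reverse.length at hj
  rw [List.length_reverse] at hj
  obtain ⟨a, b, u, w, haj, hjb, hba, hu, hw, hul, hwl⟩ :=
    forwardSetting_dense h hL (I.path.length - 2 - j)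
      (show I.path.length - 2 - j + 1 < I.path.length by omega)
  change I.path[a]? = some u at hu
  change I.path[b]? = some w at hw
  have ha := (List.getElem?_eq_some_iff.1 hu).1
  have hb := (List.getElem?_eq_some_iff.1 hw).1
  refine ⟨I.path.length - 1 - b, I.path.length - 1 - a, w, u, by omega, by omega, by omega, ?_, ?_,
    hwl, hul⟩
  · change I.path.reverse[_]? = _
    rw [List.getElem?_reverse (by omega), ← hw]
    congr 1
    omega
  · change I.path.reverse[_]? = _
    rw [List.getElem?_reverse (by omega), ← hu]
    congr 1
    omega

/-- The output of the vertex `v`. -/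
noncomputable def finalAnswer (I : RPathsInstance n) (B S ζ K k : ℕ) (flag : Fin n → Prop)
    (v : Fin n) : ℕ∞ :=
  answer (S ^ 8) ζ
    (halfResult I B (S ^ 8) ζ (phaseLength ζ k K)
      (fun v => forwardInput (I.localInput v) (flag v)) v)
    (halfResult I B (S ^ 8) ζ (phaseLength ζ k K)
      (fun v => backwardInput (I.localInput v) (flag v)) v)

/-- The walks found by the algorithm avoid the failing edge. -/
theorem replacementLength_le_finalAnswer (h : I.Suitable B S ζ K k)
    (hL : I.GoodLandmarks ζ k (I.landmarks flag)) {i : ℕ} {v w : Fin n}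
    (hv : I.path[i]? = some v) (hw : I.path[i + 1]? = some w) :
    I.replacementLength (v, w) ≤ I.finalAnswer B S ζ K k flag v := by
  have hlen := (List.getElem?_eq_some_iff.1 hw).1
  refine le_iInf₂ ?_
  rintro _ ⟨x, y, c, c', r, hc, hc', hchain, rfl⟩
  set A := forwardSetting h hL
  set A' := backwardSetting h hL
  obtain ⟨x', -, hx, j, u, m, hj, hu, hwalk, rfl⟩ := A.costs_sound (s := 0) (by omega) hv
    (fun q hq => by
      obtain ⟨r, hr⟩ := A.allPref_witness hq
      exact ⟨r, Nat.zero_le r, hr⟩) hc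
  have hv' : A'.p[I.path.length - 1 - i]? = some v := by
    change I.path.reverse[_]? = _
    rw [List.getElem?_reverse (by omega), ← hv]
    congr 1
    omega
  -- With `s = 1` on the reversed path, the walk rejoins the path at position `i + 1` or later.
  obtain ⟨y', -, hy, j', u', m', hj', hu', hwalk', rfl⟩ := A'.costs_sound (s := 1) le_rfl hv'
    (fun q hq => by
      obtain ⟨r, hr⟩ := A'.pref_witness hq
      exact ⟨r + 1, by omega, hr⟩) hc'
  obtain ⟨z, hz, hmid⟩ := A.chain_sound hchain hx
  obtain rfl : y' = z := I.ident_injective (hy.symm.trans hz)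
  change I.path[j]? = some u at hu
  change I.path.reverse[j']? = some u' at hu'
  rw [List.getElem?_reverse (by omega)] at hu'
  set H := removeEdges I.graph {(v, w)} with hH
  have hoff : ∀ a b, I.offPath a b → H.Adj a b := by
    intro a b hab
    refine ⟨hab.1.1, fun heq => hab.1.2 ?_⟩
    rw [Set.mem_singleton_iff.1 heq]
    exact mem_pathEdges_iff.2 ⟨i, hv, hw⟩
  have hon : ∀ a x y, a ≠ i → I.path[a]? = some x → I.path[a + 1]? = some y → H.Adj x y := by
    intro a x y hai hx hy
    refine ⟨I.path_isPath.adj_of_getElem? hx hy, fun heq => hai ?_⟩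
    obtain ⟨rfl, -⟩ := Prod.mk.inj (Set.mem_singleton_iff.1 heq)
    exact (List.getElem?_inj (List.getElem?_eq_some_iff.1 hx).1 I.path_isPath.nodup).1
      (hx.trans hv.symm)
  have h1 : HasWalk H.Adj j I.s u := hasWalk_of_forall_getElem? (l := I.path) (j := 0)
    (fun a x y _ ha => hon a x y (by omega)) I.path_isPath.getElem?_zero (by rwa [zero_add])
  have h2 : HasWalk H.Adj m u x' := hwalk.mono hoff
  have h3 : HasWalk H.Adj r x' y' := hmid.mono hoff
  have h4 : HasWalk H.Adj m' y' u' := hwalk'.swap.mono hoff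
  have h5 : HasWalk H.Adj j' u' I.t := hasWalk_of_forall_getElem? (l := I.path)
    (j := I.path.length - 1 - j') (fun a x y ha _ => hon a x y (by omega)) hu' (by
      rw [← I.path_isPath.getElem?_pathLength, pathLength]
      congr 1
      omega)
  have := diDist_le_of_hasWalk ((((h1.trans h2).trans h3).trans h4).trans h5)
  refine this.trans (le_of_eq ?_)
  congr 1
  ring

/-- The landmarks on a covered list of vertices off the path are connected by known facts. -/
theorem exists_chain (h : I.Suitable B S ζ K k)
    (hL : I.GoodLandmarks ζ k (I.landmarks flag)) (v : Fin n) {d : List (Fin n)}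
    (hd : ∀ a x y, d[a]? = some x → d[a + 1]? = some y → I.offPath x y)
    (hcov : Covered (I.landmarks flag) ζ d) (g : ℕ) :
    ∀ a x, a + g + 1 = d.length → d[a]? = some x → x ∈ I.landmarks flag →
      ∃ b y r, a ≤ b ∧ b < d.length ∧ d.length ≤ b + ζ + 1 ∧ d[b]? = some y ∧
        y ∈ I.landmarks flag ∧ r ≤ b - a ∧
        Chain ((forwardSetting h hL).facts v) (I.ident x) (I.ident y) r := by
  induction g using Nat.strong_induction_on with
  | _ g ih =>
  intro a x hag hx hxl
  by_cases hcase : d.length ≤ a + ζ + 1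
  · exact ⟨a, x, 0, le_rfl, by omega, hcase, hx, hxl, by omega, Chain.refl _⟩
  -- Starting the window at `a + 1` forces progress and still gives a hop of at most `ζ` steps.
  · obtain ⟨b, hb1, hb2, y, hyl, hy⟩ := hcov (a + 1) (by omega)
    have hwalk : HasWalk I.offPath (b - a) x y := hasWalk_of_forall_getElem? (l := d) (j := a)
      (fun a x y _ _ => hd a x y) hx (by rwa [Nat.add_sub_cancel' (by omega)])
    obtain ⟨r, hr, hfact⟩ := (forwardSetting h hL).fact_zero_complete v hxl hyl hwalk (by omega)
    obtain ⟨b', y', r', h1, h2, h3, h4, h5, h6, h7⟩ :=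
      ih (g - (b - a)) (by omega) b y (by omega) hy hyl
    exact ⟨b', y', r + r', by omega, h2, h3, h4, h5, by omega, Chain.step hfact h7⟩

/-- The algorithm finds all replacement paths with covered long detours. -/
theorem finalAnswer_le_longDetourLength (h : I.Suitable B S ζ K k)
    (hL : I.GoodLandmarks ζ k (I.landmarks flag)) {i : ℕ} {v : Fin n}
    (hv : I.path[i]? = some v) (hi : i + 1 < I.path.length) :
    I.finalAnswer B S ζ K k flag v ≤ I.longDetourLength i := by
  refine le_iInf₂ fun q d => le_iInf ?_
  rintro ⟨⟨j, l, hj, hl, hji, hil, hd, rfl⟩, hlong⟩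
  obtain ⟨d', hd', hlen', hle, hcov⟩ := hL.detour_covered _ _ d hd hlong
  set A := forwardSetting h hL
  set A' := backwardSetting h hL
  have hoff : ∀ a x y, d'[a]? = some x → d'[a + 1]? = some y → I.offPath x y :=
    fun a x y hx hy => ⟨hd'.adj_of_getElem? hx hy, hd'.ne_of_getElem? hx hy⟩
  obtain ⟨a, -, haζ, x, hxl, hx⟩ := hcov 0 (by omega)
  have halen := (List.getElem?_eq_some_iff.1 hx).1
  obtain ⟨b, y, r, hab, hblen, hbζ, hy, hyl, hr, hchain⟩ :=
    exists_chain h hL v hoff hcov (d'.length - 1 - a) a x (by omega) hx hxl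
  have hdlast := hd'.getElem?_pathLength
  rw [pathLength] at hdlast
  have hw1 : HasWalk I.offPath a I.path[j] x := hasWalk_of_forall_getElem? (l := d') (j := 0)
    (fun a x y _ _ => hoff a x y) hd'.getElem?_zero (by rwa [zero_add])
  have hw2 : HasWalk I.offPath (d'.length - 1 - b) y I.path[l] :=
    hasWalk_of_forall_getElem? (l := d') (j := b) (fun a x y _ _ => hoff a x y) hy (by
      rw [← hdlast]
      congr 1
      omega)
  obtain ⟨c, hc, hcle⟩ := A.costs_complete (forwardSetting_dense h hL) hv
    (List.getElem?_eq_getElem hj) hji (show j + 1 < I.path.length by omega) hxl (by omega) hw1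
    (Or.inl rfl)
  have hv' : A'.p[I.path.length - 1 - i]? = some v := by
    change I.path.reverse[_]? = _
    rw [List.getElem?_reverse (by omega), ← hv]
    congr 1
    omega
  have hu' : A'.p[I.path.length - 1 - l]? = some I.path[l] := by
    change I.path.reverse[_]? = _
    rw [List.getElem?_reverse (by omega), ← List.getElem?_eq_getElem hl]
    congr 1
    omega
  obtain ⟨c', hc', hcle'⟩ := A'.costs_complete (backwardSetting_dense h hL) hv' hu' (by omega)
    (show _ < I.path.reverse.length by rw [List.length_reverse]; omega) hyl (by omega) hw2.swap
    (Or.inr ⟨rfl, by omega⟩)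
  -- The bounds telescope along `d'`: its parts before `x`, between `x` and `y`, and after `y` add
  -- up to its length.
  refine (iInf₂_le (c + r + c') ⟨_, _, c, c', r, hc, hc', hchain, rfl⟩).trans ?_
  have hpos := hd.length_pos
  simp only [pathLength, List.length_append, List.length_take, List.length_drop] at hle ⊢
  rw [Nat.min_eq_left hj.le]
  exact_mod_cast (by omega)

/-- All vertices halt within a number of rounds that does not depend on the landmarks, and the
outputs are correct if the landmarks are good. -/
theorem exec_complete (hS : 0 < S) (hB : (4 * n + 3) * S ^ 8 < 2 ^ B)
    (hsuit : ∀ K, (∀ u v, I.network.dist u v ≤ 2 * K) → K ≤ 2 * I.network.diam + 1 →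
      I.Suitable B S ζ K k) :
    ∃ T, T ≤ 12 * (2 * I.network.diam + 1) +
        8 * (phaseLength ζ k (2 * I.network.diam + 1) + 1) ∧
      ∀ flag : Fin n → Prop, ∃ o,
        Exec I B (S ^ 8) (fun v => complete n (S ^ 8) ζ k (I.localInput v) (flag v)) T o ∧
        (I.GoodLandmarks ζ k (I.landmarks flag) →
          ∀ (i : ℕ) (hi : i + 1 < I.path.length),
            I.replacementLength (I.path[i], I.path[i + 1]) ≤ o I.path[i] ∧
            o I.path[i] ≤ I.longDetourLength i) := by
  have hG : I.network.Connected := I.connected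
  have hdiam := hG.diam_lt_card
  rw [Fintype.card_fin] at hdiam
  obtain ⟨K, T, hK, hKd, hT, hexec⟩ := exec_probe I (Nat.pow_pos hS) hB n 1 le_rfl
    (by rw [one_mul]; exact (hdiam.trans Nat.lt_two_pow_self).le) (by omega)
  have hdist : ∀ u v, I.network.dist u v ≤ 2 * K := by
    intro u v
    have h1 := hG.dist_triangle (u := u) (v := I.s) (w := v)
    have h2 := hK u
    have h3 := hK v
    rw [SimpleGraph.dist_comm] at h2
    omega
  have hs := hsuit K hdist hKd
  -- `K` and `T` were fixed before the flags, so the round bound holds for all random bits.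
  refine ⟨0 + 4 * (phaseLength ζ k K + 1) + 4 * (phaseLength ζ k K + 1) + T, ?_, fun flag =>
    ⟨I.finalAnswer B S ζ K k flag, ?_, fun hL i hi => ⟨?_, ?_⟩⟩⟩
  · simp only [phaseLength]
    omega
  · refine hexec (fun v K => half (S ^ 8) ζ (phaseLength ζ k K)
      (forwardInput (I.localInput v) (flag v)) fun r₁ =>
      half (S ^ 8) ζ (phaseLength ζ k K) (backwardInput (I.localInput v) (flag v)) fun r₂ =>
      halt (answer (S ^ 8) ζ r₁ r₂)) _ _ ?_
    refine exec_half I B (S ^ 8) ζ (phaseLength ζ k K)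
      (fun v => forwardInput (I.localInput v) (flag v)) ?_
    refine exec_half I B (S ^ 8) ζ (phaseLength ζ k K)
      (fun v => backwardInput (I.localInput v) (flag v)) ?_
    exact exec_halt I B (S ^ 8) (I.finalAnswer B S ζ K k flag)
  · exact replacementLength_le_finalAnswer hs hL (List.getElem?_eq_getElem (by omega))
      (List.getElem?_eq_getElem hi)
  · exact finalAnswer_le_longDetourLength hs hL (List.getElem?_eq_getElem (by omega)) hi

end RPathsInstance

/-! ## Random landmarks -/

section Counting

variable {V X : Type} [Fintype V] [DecidableEq V] [Fintype X] [DecidableEq X]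

theorem card_avoiding (x₀ : X) (S : Finset V) :
    ((Finset.univ.filter fun ω : V → X => ∀ v ∈ S, ω v ≠ x₀).card : ℝ) =
      (1 - 1 / (Fintype.card X : ℝ)) ^ S.card * Fintype.card (V → X) := by
  have hq : (Fintype.card X : ℝ) ≠ 0 := by
    have : Nonempty X := ⟨x₀⟩
    exact_mod_cast Fintype.card_ne_zero
  have hset : (Finset.univ.filter fun ω : V → X => ∀ v ∈ S, ω v ≠ x₀) =
      Fintype.piFinset fun v => if v ∈ S then Finset.univ.erase x₀ else Finset.univ := by
    ext ω
    simp only [Finset.mem_filter, Finset.mem_univ, true_and, Fintype.mem_piFinset]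
    refine forall_congr' fun v => ?_
    split_ifs with h <;> simp [h]
  have hcard : ∀ v : V, (((if v ∈ S then Finset.univ.erase x₀ else Finset.univ : Finset X).card : ℕ) : ℝ) =
      (if v ∈ S then 1 - 1 / (Fintype.card X : ℝ) else 1) * Fintype.card X := by
    intro v
    split_ifs
    · rw [Finset.card_erase_of_mem (Finset.mem_univ _), Nat.cast_sub
        (Finset.card_pos.2 ⟨x₀, Finset.mem_univ _⟩), Finset.card_univ]
      field_simp
      simp
    · simp [Finset.card_univ]
  rw [hset, Fintype.card_piFinset, Nat.cast_prod, Finset.prod_congr rfl fun v _ => hcard v,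
    Finset.prod_mul_distrib, Finset.prod_ite_mem, Finset.univ_inter, Finset.prod_const,
    Finset.prod_const, Finset.card_univ, Fintype.card_fun]
  push_cast
  rfl

/-- Markov's inequality for `2 ^ X`, where `X` counts the vertices that draw `x₀`; by independence
its mean is `(1 + 1 / |X|) ^ |V|`, with `|X|` here the number of values. -/
theorem card_many_le (x₀ : X) (k : ℕ) :
    ((Finset.univ.filter fun ω : V → X => k ≤ (Finset.univ.filter fun v => ω v = x₀).card).card : ℝ)
      ≤ (1 + 1 / (Fintype.card X : ℝ)) ^ Fintype.card V / 2 ^ k * Fintype.card (V → X) := by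
  have hq : (Fintype.card X : ℝ) ≠ 0 := by
    have : Nonempty X := ⟨x₀⟩
    exact_mod_cast Fintype.card_ne_zero
  have hsum : ∑ ω : V → X, (2 : ℝ) ^ (Finset.univ.filter fun v => ω v = x₀).card =
      (1 + Fintype.card X) ^ Fintype.card V := by
    have h1 : ∀ ω : V → X, (2 : ℝ) ^ (Finset.univ.filter fun v => ω v = x₀).card =
        ∏ v, if ω v = x₀ then 2 else 1 := by
      intro ω
      rw [← Finset.prod_const, Finset.prod_filter]
    have h2 : ∑ x : X, (if x = x₀ then (2 : ℝ) else 1) = 1 + Fintype.card X := by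
      have : ∀ x : X, (if x = x₀ then (2 : ℝ) else 1) = (if x = x₀ then 1 else 0) + 1 := by
        intro x
        split_ifs <;> norm_num
      simp [this, Finset.sum_add_distrib]
    rw [Finset.sum_congr rfl fun ω _ => h1 ω]
    have := Finset.prod_univ_sum (fun _ : V => (Finset.univ : Finset X))
      fun _ x => if x = x₀ then (2 : ℝ) else 1
    rw [Fintype.piFinset_univ] at this
    rw [← this, h2, Finset.prod_const, Finset.card_univ]
  rw [div_mul_eq_mul_div, le_div_iff₀ (by positivity)]
  calc _ = ∑ _ω ∈ Finset.univ.filter fun ω : V → X =>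
          k ≤ (Finset.univ.filter fun v => ω v = x₀).card, (2 : ℝ) ^ k := by
        rw [Finset.sum_const, nsmul_eq_mul]
    _ ≤ ∑ ω ∈ Finset.univ.filter fun ω : V → X =>
          k ≤ (Finset.univ.filter fun v => ω v = x₀).card,
          (2 : ℝ) ^ (Finset.univ.filter fun v => ω v = x₀).card :=
        Finset.sum_le_sum fun ω hω =>
          pow_le_pow_right₀ one_le_two (Finset.mem_filter.1 hω).2
    _ ≤ ∑ ω : V → X, (2 : ℝ) ^ (Finset.univ.filter fun v => ω v = x₀).card :=
        Finset.sum_le_sum_of_subset_of_nonneg (Finset.filter_subset _ _) fun _ _ _ => by positivity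
    _ = _ := by
        rw [hsum, Fintype.card_fun]
        push_cast
        rw [← mul_pow]
        congr 1
        field_simp
        ring

/-- Random sets are small and hit all members of a family of sets with `ζ` elements. -/
theorem card_bad_le (x₀ : X) (k ζ : ℕ) {ι : Type} [Fintype ι] (S : ι → Finset V)
    (hS : ∀ i, (S i).card = ζ) :
    ((Finset.univ.filter fun ω : V → X => k ≤ (Finset.univ.filter fun v => ω v = x₀).card ∨
        ∃ i, ∀ v ∈ S i, ω v ≠ x₀).card : ℝ) ≤
      ((1 + 1 / (Fintype.card X : ℝ)) ^ Fintype.card V / 2 ^ k +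
        Fintype.card ι * (1 - 1 / (Fintype.card X : ℝ)) ^ ζ) * Fintype.card (V → X) := by
  classical
  have hsub : (Finset.univ.filter fun ω : V → X =>
      k ≤ (Finset.univ.filter fun v => ω v = x₀).card ∨ ∃ i, ∀ v ∈ S i, ω v ≠ x₀) ⊆
      (Finset.univ.filter fun ω : V → X => k ≤ (Finset.univ.filter fun v => ω v = x₀).card) ∪
      Finset.univ.biUnion fun i => Finset.univ.filter fun ω : V → X => ∀ v ∈ S i, ω v ≠ x₀ := by
    intro ω hω
    simpa using hω
  have h1 : ((Finset.univ.biUnion fun i => Finset.univ.filter fun ω : V → X =>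
      ∀ v ∈ S i, ω v ≠ x₀).card : ℝ) ≤
      Fintype.card ι * (1 - 1 / (Fintype.card X : ℝ)) ^ ζ * Fintype.card (V → X) := by
    calc _ ≤ ((∑ i, (Finset.univ.filter fun ω : V → X => ∀ v ∈ S i, ω v ≠ x₀).card : ℕ) : ℝ) := by
          exact_mod_cast Finset.card_biUnion_le
      _ = _ := by
          rw [Nat.cast_sum, Finset.sum_congr rfl fun i _ => (card_avoiding x₀ (S i)).trans (by rw [hS i]),
            Finset.sum_const, Finset.card_univ, nsmul_eq_mul]
          ring
  have h2 := card_many_le (V := V) x₀ k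
  calc _ ≤ (((Finset.univ.filter fun ω : V → X =>
          k ≤ (Finset.univ.filter fun v => ω v = x₀).card).card +
        (Finset.univ.biUnion fun i => Finset.univ.filter fun ω : V → X =>
          ∀ v ∈ S i, ω v ≠ x₀).card : ℕ) : ℝ) := by
        exact_mod_cast (Finset.card_le_card hsub).trans (Finset.card_union_le _ _)
    _ ≤ _ := by
        push_cast
        linarith

end Counting

/-- An event that occurs whenever an unlikely event does not occur is likely. -/
theorem le_coinProb {n R : ℕ} {E : (Fin n → Fin R → Bool) → Prop}
    {bad : Finset (Fin n → Fin R → Bool)} {δ : ℝ} (h : ∀ ω, ω ∉ bad → E ω)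
    (hbad : (bad.card : ℝ) ≤ δ * Fintype.card (Fin n → Fin R → Bool)) : 1 - δ ≤ coinProb E := by
  classical
  have hpos : (0 : ℝ) < Fintype.card (Fin n → Fin R → Bool) := by exact_mod_cast Fintype.card_pos
  rw [coinProb, Nat.card_eq_fintype_card, Nat.card_eq_fintype_card, le_div_iff₀ hpos,
    Fintype.card_subtype]
  have hsub : badᶜ ⊆ Finset.univ.filter E := fun ω hω =>
    Finset.mem_filter.2 ⟨Finset.mem_univ _, h ω (Finset.mem_compl.1 hω)⟩
  have h1 := Finset.card_le_card hsub
  have h2 := bad.card_add_card_compl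
  have h3 : (Fintype.card (Fin n → Fin R → Bool) : ℝ) ≤ bad.card + (Finset.univ.filter E).card := by
    exact_mod_cast h2 ▸ Nat.add_le_add_left h1 _
  linarith

theorem coinProb_mono {n R : ℕ} {E E' : (Fin n → Fin R → Bool) → Prop} (h : ∀ ω, E ω → E' ω) :
    coinProb E ≤ coinProb E' := by
  refine div_le_div_of_nonneg_right ?_ (Nat.cast_nonneg _)
  exact_mod_cast Nat.card_le_card_of_injective (fun ω : {ω // E ω} => (⟨ω.1, h _ ω.2⟩ : {ω // E' ω}))
    fun _ _ heq => Subtype.ext (congrArg (fun z => z.1) heq)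

/-! ### The windows to be hit by landmarks -/

namespace RPathsInstance

variable {n : ℕ} (I : RPathsInstance n)

/-- The long paths off the path from `u` to `v`. -/
def longDetours (u v : Fin n) : Set (List (Fin n)) :=
  {d | IsDiPath (removeEdges I.graph (pathEdges I.path)) u v d ∧ IsLongDetour n d}

theorem exists_shortest_longDetour (u v : Fin n) :
    ∃ d' : List (Fin n), d'.Nodup ∧ ((I.longDetours u v).Nonempty → d' ∈ I.longDetours u v ∧
      ∀ d ∈ I.longDetours u v, pathLength d' ≤ pathLength d) := by
  by_cases hne : (I.longDetours u v).Nonempty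
  · have hne' : (pathLength '' I.longDetours u v).Nonempty := hne.image _
    obtain ⟨d', hd', hlen⟩ := Nat.sInf_mem hne'
    exact ⟨d', hd'.1.nodup, fun _ => ⟨hd', fun d hd => hlen ▸ Nat.sInf_le ⟨d, hd, rfl⟩⟩⟩
  · exact ⟨[], List.nodup_nil, fun h => absurd h hne⟩

/-- There are `n ^ 2 + 1` lists, the path and a shortest long detour for each pair of ends (the
empty list if there is none), with at most `n` window positions each. The two extra landmarks are
`s` and `t`. -/
theorem exists_windows (ζ : ℕ) (hζ : 0 < ζ) (hζn : (ζ : ℝ) ≤ (n : ℝ) ^ (2 / 3 : ℝ)) :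
    ∃ (ι : Type) (_ : Fintype ι) (W : ι → Finset (Fin n)), Fintype.card ι ≤ (n ^ 2 + 1) * n ∧
      (∀ i, (W i).card = ζ) ∧ ∀ (flag : Fin n → Prop) (k : ℕ), {v | flag v}.ncard ≤ k →
        (∀ i, ∃ v ∈ W i, flag v) → I.GoodLandmarks ζ (k + 2) (I.landmarks flag) := by
  classical
  choose f hf hf' using I.exists_shortest_longDetour
  let g : Option (Fin n × Fin n) → List (Fin n) := fun o => o.elim I.path fun z => f z.1 z.2
  have hg : ∀ o, (g o).Nodup := by
    rintro (_ | z)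
    exacts [I.path_isPath.nodup, hf z.1 z.2]
  refine ⟨{z : Option (Fin n × Fin n) × Fin n // z.2 + ζ ≤ (g z.1).length}, inferInstance,
    fun z => (((g z.1.1).drop z.1.2).take ζ).toFinset, ?_, ?_, ?_⟩
  · refine (Fintype.card_subtype_le _).trans ?_
    simp [Fintype.card_prod, Fintype.card_option, sq]
  · rintro ⟨⟨o, a⟩, h⟩
    rw [List.toFinset_card_of_nodup (((hg o).sublist (List.drop_sublist _ _)).sublist
      (List.take_sublist _ _)), List.length_take, List.length_drop]
    change (a : ℕ) + ζ ≤ (g o).length at h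
    change min ζ ((g o).length - a) = ζ
    omega
  · intro flag k hk hW
    have hcov : ∀ o, Covered (I.landmarks flag) ζ (g o) := by
      intro o a ha
      have hlen : (g o).length ≤ n := by simpa using (hg o).length_le_card
      obtain ⟨v, hv, hfl⟩ := hW ⟨(o, ⟨a, by omega⟩), ha⟩
      rw [List.mem_toFinset, List.mem_iff_getElem?] at hv
      obtain ⟨b, hb⟩ := hv
      have hbζ : b < ζ := by
        have := (List.getElem?_eq_some_iff.1 hb).1
        rw [List.length_take] at this
        omega
      rw [List.getElem?_take, if_pos hbζ, List.getElem?_drop] at hb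
      exact ⟨a + b, by omega, by omega, v, Or.inl hfl, hb⟩
    refine ⟨Or.inr (Or.inl rfl), Or.inr (Or.inr rfl), ?_, hcov none, ?_⟩
    · have : I.landmarks flag = {v | flag v} ∪ {I.s, I.t} := by
        ext v
        simp only [landmarks, Set.mem_union, Set.mem_insert_iff, Set.mem_singleton_iff,
          Set.mem_ofPred_eq]
      rw [this]
      refine (Set.ncard_union_le _ _).trans (Nat.add_le_add hk ?_)
      exact (Set.ncard_insert_le _ _).trans (by rw [Set.ncard_singleton])
    · intro u v d hd hlong
      obtain ⟨⟨h1, h2⟩, h3⟩ := hf' u v ⟨d, hd, hlong⟩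
      refine ⟨f u v, h1, ?_, h3 d ⟨hd, hlong⟩, hcov (some (u, v))⟩
      have h4 : (ζ : ℝ) < pathLength (f u v) := hζn.trans_lt h2
      have h5 : ζ < pathLength (f u v) := by exact_mod_cast h4
      simp only [pathLength] at h5
      omega

end RPathsInstance

/-! ## Choice of the parameters -/

namespace Parameters

/-- The number of bits of the numbers up to `n`. -/
def bits (n : ℕ) : ℕ := Nat.log 2 n + 1

/-- The number of vertices in a window. -/
noncomputable def window (n : ℕ) : ℕ := ⌊(n : ℝ) ^ (2 / 3 : ℝ)⌋₊

/-- The expected number of landmarks in a window, if the window is large enough. -/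
def rate (a n : ℕ) : ℕ := (a + 5) * bits n

/-- The number of random bits of a vertex. -/
noncomputable def coins (a n : ℕ) : ℕ := Nat.log 2 (window n / rate a n)

/-- The bound for the number of random landmarks. -/
noncomputable def maxRandom (a n : ℕ) : ℕ := 2 * (n / 2 ^ coins a n + 1) + a * bits n + 1

theorem lt_two_pow_bits (n : ℕ) : n < 2 ^ bits n := Nat.lt_pow_succ_log_self one_lt_two n

theorem bits_pos (n : ℕ) : 0 < bits n := Nat.succ_pos _

theorem rate_pos (a n : ℕ) : 0 < rate a n := Nat.mul_pos (by omega) (bits_pos n)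

variable {n : ℕ}

theorem one_le_rpow (hn : 1 ≤ n) : (1 : ℝ) ≤ (n : ℝ) ^ (2 / 3 : ℝ) :=
  Real.one_le_rpow (by exact_mod_cast hn) (by norm_num)

theorem window_le_rpow : (window n : ℝ) ≤ (n : ℝ) ^ (2 / 3 : ℝ) := Nat.floor_le (by positivity)

theorem window_pos (hn : 1 ≤ n) : 0 < window n := Nat.floor_pos.2 (one_le_rpow hn)

theorem rpow_le_two_mul_window (hn : 1 ≤ n) : (n : ℝ) ^ (2 / 3 : ℝ) ≤ 2 * window n := by
  have h1 := Nat.lt_floor_add_one ((n : ℝ) ^ (2 / 3 : ℝ))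
  have h2 : (1 : ℝ) ≤ window n := by exact_mod_cast window_pos hn
  have h3 : (n : ℝ) ^ (2 / 3 : ℝ) < window n + 1 := h1
  linarith

theorem window_le (hn : 1 ≤ n) : window n ≤ n := by
  have h1 : (n : ℝ) ^ (2 / 3 : ℝ) ≤ (n : ℝ) ^ (1 : ℝ) :=
    Real.rpow_le_rpow_of_exponent_le (by exact_mod_cast hn) (by norm_num)
  rw [Real.rpow_one] at h1
  exact_mod_cast window_le_rpow.trans h1

theorem window_lt (a n : ℕ) : window n < 2 ^ coins a n * 2 * rate a n := by
  have h1 := Nat.lt_pow_succ_log_self one_lt_two (window n / rate a n)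
  rw [Nat.div_lt_iff_lt_mul (rate_pos a n)] at h1
  rwa [pow_succ] at h1

theorem bits_le (hn : 1 ≤ n) : (bits n : ℝ) ≤ 2 * (Real.log n + 1) := by
  have h1 : (2 : ℝ) ^ Nat.log 2 n ≤ n := by exact_mod_cast Nat.pow_log_le_self 2 (by omega)
  have h2 := Real.log_le_log (by positivity) h1
  rw [Real.log_pow] at h2
  have h3 := Real.log_two_gt_d9
  have h4 : (0 : ℝ) ≤ Nat.log 2 n := by positivity
  rw [bits]
  push_cast
  nlinarith

/-- With `μ ≥ n / q`, the mean of `2 ^ X` is at most `e ^ μ ≤ 2 ^ (2 * μ)`; the remaining `a * bits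
n + 1` in the exponent pay for `1 / n ^ a / 2`. -/
theorem many_le (a : ℕ) (hn : 1 ≤ n) :
    (1 + 1 / (2 ^ coins a n : ℝ)) ^ n / 2 ^ maxRandom a n ≤ 1 / (n : ℝ) ^ a / 2 := by
  set q : ℝ := 2 ^ coins a n with hq
  have hq0 : 0 < q := by positivity
  set μ : ℕ := n / 2 ^ coins a n + 1 with hμ
  have h1 : (n : ℝ) / q ≤ μ := by
    rw [div_le_iff₀ hq0, hq, hμ]
    exact_mod_cast (Nat.lt_mul_of_div_lt (Nat.lt_succ_self (n / 2 ^ coins a n))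
      (by positivity)).le
  have h2 : (1 + 1 / q) ^ n ≤ (2 : ℝ) ^ (2 * μ) := by
    calc (1 + 1 / q) ^ n ≤ (Real.exp (1 / q)) ^ n := by
          refine pow_le_pow_left₀ (by positivity) ?_ n
          rw [add_comm]
          exact Real.add_one_le_exp _
      _ = Real.exp (n / q) := by rw [← Real.exp_nat_mul]; congr 1; ring
      _ ≤ Real.exp (μ : ℝ) := Real.exp_le_exp.2 h1
      _ = (Real.exp 1) ^ μ := by rw [← Real.exp_nat_mul, mul_one]
      _ ≤ (2 ^ 2) ^ μ := by
          refine pow_le_pow_left₀ (by positivity) ?_ μ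
          have := Real.exp_one_lt_d9
          linarith
      _ = 2 ^ (2 * μ) := (pow_mul _ _ _).symm
  have h3 : (n : ℝ) ^ a ≤ 2 ^ (a * bits n) := by
    rw [mul_comm, pow_mul]
    exact pow_le_pow_left₀ (by positivity) (by exact_mod_cast (lt_two_pow_bits n).le) a
  have hn0 : (0 : ℝ) < (n : ℝ) ^ a := by
    have : (0 : ℝ) < n := by exact_mod_cast hn
    positivity
  have h4 : (2 : ℝ) ^ maxRandom a n = 2 ^ (2 * μ) * 2 ^ (a * bits n) * 2 := by
    rw [maxRandom, ← hμ, pow_add, pow_add, pow_one]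
  rw [h4, div_le_iff₀ (by positivity)]
  calc (1 + 1 / q) ^ n ≤ 2 ^ (2 * μ) := h2
    _ = 1 / (n : ℝ) ^ a / 2 * (2 ^ (2 * μ) * (n : ℝ) ^ a * 2) := by field_simp
    _ ≤ _ := by gcongr

/-- If the window is shorter than the rate, no coins are flipped and every vertex is a landmark.
Otherwise a window expects at least `rate a n` landmarks and is missed with probability at most `e ^
(-rate a n)`. -/
theorem miss_le (a : ℕ) (hn : 1 ≤ n) :
    (1 - 1 / (2 ^ coins a n : ℝ)) ^ window n ≤ 1 / 2 ^ rate a n := by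
  by_cases hz : window n / rate a n = 0
  · have : coins a n = 0 := by rw [coins, hz, Nat.log_zero_right]
    rw [this]
    simp [(window_pos hn).ne']
  · have h1 : 2 ^ coins a n * rate a n ≤ window n :=
      (Nat.le_div_iff_mul_le (rate_pos a n)).1 (Nat.pow_log_le_self 2 hz)
    set q : ℝ := 2 ^ coins a n with hq
    have hq1 : 1 ≤ q := one_le_pow₀ one_le_two
    have h2 : (rate a n : ℝ) ≤ window n / q := by
      rw [le_div_iff₀ (by positivity), mul_comm, hq]
      exact_mod_cast h1
    calc (1 - 1 / q) ^ window n ≤ (Real.exp (-(1 / q))) ^ window n := by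
          refine pow_le_pow_left₀ (sub_nonneg.2 ?_) ?_ _
          · rw [div_le_one (by positivity)]
            exact hq1
          · have := Real.add_one_le_exp (-(1 / q))
            linarith
      _ = Real.exp (-(window n / q)) := by rw [← Real.exp_nat_mul]; congr 1; ring
      _ ≤ Real.exp (-(rate a n : ℝ)) := Real.exp_le_exp.2 (neg_le_neg h2)
      _ = 1 / (Real.exp 1) ^ rate a n := by
          rw [← Real.exp_nat_mul, mul_one, Real.exp_neg, one_div]
      _ ≤ 1 / 2 ^ rate a n := by
          gcongr
          have := Real.exp_one_gt_d9
          linarith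

/-- The 5 in `rate` is 3 for the number of windows and 2 for the constant 4. -/
theorem windows_miss_le (a : ℕ) (hn : 1 ≤ n) :
    (((n ^ 2 + 1) * n : ℕ) : ℝ) * (1 - 1 / (2 ^ coins a n : ℝ)) ^ window n ≤
      1 / (n : ℝ) ^ a / 2 := by
  have hn1 : (1 : ℝ) ≤ n := by exact_mod_cast hn
  have hn0 : (0 : ℝ) < (n : ℝ) := by linarith
  have h1 : (((n ^ 2 + 1) * n : ℕ) : ℝ) ≤ 2 * (n : ℝ) ^ 3 := by
    push_cast
    nlinarith [mul_le_mul hn1 hn1 zero_le_one hn0.le]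
  have hw : (n : ℝ) ≤ 2 ^ bits n := by exact_mod_cast (lt_two_pow_bits n).le
  have h2w : (2 : ℝ) ≤ 2 ^ bits n := by
    calc (2 : ℝ) = 2 ^ 1 := (pow_one 2).symm
      _ ≤ 2 ^ bits n := pow_le_pow_right₀ one_le_two (bits_pos n)
  have h2 : 4 * (n : ℝ) ^ 3 * (n : ℝ) ^ a ≤ 2 ^ rate a n := by
    have : (2 : ℝ) ^ rate a n = (2 ^ bits n) ^ 2 * (2 ^ bits n) ^ 3 * (2 ^ bits n) ^ a := by
      rw [rate, ← pow_add, ← pow_add, ← pow_mul]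
      congr 1
      ring
    rw [this]
    have h4 : (4 : ℝ) ≤ (2 ^ bits n) ^ 2 := by nlinarith
    gcongr
  refine (mul_le_mul h1 (miss_le a hn) (pow_nonneg ?_ _) (by positivity)).trans ?_
  · rw [sub_nonneg, div_le_one (by positivity)]
    exact one_le_pow₀ one_le_two
  · rw [mul_one_div, div_le_iff₀ (by positivity)]
    calc 2 * (n : ℝ) ^ 3 = 1 / (n : ℝ) ^ a / 2 * (4 * (n : ℝ) ^ 3 * (n : ℝ) ^ a) := by
          field_simp
          norm_num
      _ ≤ _ := by gcongr

/-- The number of landmarks is `Õ(n ^ (1 / 3))`. -/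
theorem maxRandom_sq_le (a : ℕ) (hn : 1 ≤ n) :
    ((maxRandom a n + 2 : ℕ) : ℝ) ^ 2 ≤
      324 * (a + 5) ^ 2 * (n : ℝ) ^ (2 / 3 : ℝ) * (Real.log n + 1) ^ 2 := by
  have hn1 : (1 : ℝ) ≤ n := by exact_mod_cast hn
  have hn0 : (0 : ℝ) < (n : ℝ) := by linarith
  set y : ℝ := (n : ℝ) ^ (1 / 3 : ℝ) with hy
  have hy1 : 1 ≤ y := Real.one_le_rpow hn1 (by norm_num)
  have hy2 : (n : ℝ) ^ (2 / 3 : ℝ) = y ^ 2 := by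
    rw [hy, ← Real.rpow_natCast, ← Real.rpow_mul hn0.le]
    norm_num
  have hy3 : (n : ℝ) = y * y ^ 2 := by
    rw [← hy2, hy, ← Real.rpow_add hn0]
    norm_num
  have hwin := rpow_le_two_mul_window hn
  rw [hy2] at hwin
  have hlt : (window n : ℝ) < 2 ^ coins a n * 2 * rate a n := by exact_mod_cast window_lt a n
  have hdiv : ((n / 2 ^ coins a n : ℕ) : ℝ) ≤ 4 * rate a n * y := by
    refine Nat.cast_div_le.trans ?_
    push_cast
    rw [div_le_iff₀ (by positivity)]
    calc (n : ℝ) = y * y ^ 2 := hy3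
      _ ≤ y * (2 * (2 ^ coins a n * 2 * rate a n)) := by gcongr; linarith
      _ = _ := by ring
  have hrate : (rate a n : ℝ) = (a + 5) * bits n := by rw [rate]; push_cast; ring
  have hw1 : (1 : ℝ) ≤ bits n := by exact_mod_cast bits_pos n
  have hr0 : (0 : ℝ) ≤ rate a n := by positivity
  -- Twice the bound `4 * rate * y` gives 8, and the lower order terms fit into one more `rate * y`.
  have hk : ((maxRandom a n + 2 : ℕ) : ℝ) ≤ 9 * rate a n * y := by
    rw [maxRandom]
    push_cast
    have : (a : ℝ) * bits n + 5 ≤ rate a n := by rw [hrate]; nlinarith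
    nlinarith
  have hlog : 0 ≤ Real.log n := Real.log_nonneg hn1
  calc ((maxRandom a n + 2 : ℕ) : ℝ) ^ 2 ≤ (9 * rate a n * y) ^ 2 := by gcongr
    _ = 81 * (a + 5) ^ 2 * y ^ 2 * (bits n : ℝ) ^ 2 := by rw [hrate]; ring
    _ ≤ 81 * (a + 5) ^ 2 * y ^ 2 * (2 * (Real.log n + 1)) ^ 2 := by
        gcongr
        exact bits_le hn
    _ = _ := by rw [hy2]; ring

/-- With high probability the landmarks are good. -/
theorem good_likely (a : ℕ) (I : RPathsInstance n) :
    1 - 1 / (n : ℝ) ^ a ≤ coinProb fun ω : Fin n → Fin (coins a n) → Bool =>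
      I.GoodLandmarks (window n) (maxRandom a n + 2) (I.landmarks fun v => ∀ i, ω v i = true) := by
  classical
  have hn : 1 ≤ n := by have := I.s.pos; omega
  obtain ⟨ι, _, W, hι, hW, hgood⟩ := I.exists_windows (window n) (window_pos hn) window_le_rpow
  have hbad := card_bad_le (fun _ : Fin (coins a n) => true) (maxRandom a n) (window n) W hW
  refine le_coinProb ?_ (hbad.trans (mul_le_mul_of_nonneg_right ?_ (Nat.cast_nonneg _)))
  · intro ω hω
    simp only [Finset.mem_filter, Finset.mem_univ, true_and, not_or, not_le, not_exists,
      not_forall, not_not] at hω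
    refine hgood _ _ ?_ fun i => ?_
    · refine le_trans (le_of_eq ?_) hω.1.le
      rw [← Set.ncard_coe_finset]
      congr 1
      ext v
      simp [funext_iff]
    · obtain ⟨v, hv, hωv⟩ := hω.2 i
      exact ⟨v, hv, fun j => congrFun hωv j⟩
  · have hcard : (Fintype.card (Fin (coins a n) → Bool) : ℝ) = 2 ^ coins a n := by simp
    rw [hcard, Fintype.card_fin]
    have h1 := many_le a hn
    have h2 := windows_miss_le a hn
    have h3 : (0 : ℝ) ≤ (1 - 1 / (2 ^ coins a n : ℝ)) ^ window n := by
      refine pow_nonneg ?_ _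
      rw [sub_nonneg, div_le_one (by positivity)]
      exact one_le_pow₀ one_le_two
    have h4 : (Fintype.card ι : ℝ) * (1 - 1 / (2 ^ coins a n : ℝ)) ^ window n ≤
        (((n ^ 2 + 1) * n : ℕ) : ℝ) * (1 - 1 / (2 ^ coins a n : ℝ)) ^ window n :=
      mul_le_mul_of_nonneg_right (by exact_mod_cast hι) h3
    linarith

theorem rounds_le (a : ℕ) (hn : 1 ≤ n) {T D : ℝ} (hD : 0 ≤ D)
    (hT : T ≤ 12 * (2 * D + 1) + 8 * (4 * window n + 2 * (2 * D + 1) +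
      3 * ((maxRandom a n + 2 : ℕ) : ℝ) ^ 2 + 1 + 1)) :
    T ≤ (200 + 24 * 324 * (a + 5) ^ 2) * ((n : ℝ) ^ (2 / 3 : ℝ) + D) * (Real.log n + 1) ^ 2 := by
  have h2 := maxRandom_sq_le a hn
  have h3 := window_le_rpow (n := n)
  have h4 := one_le_rpow hn
  have hlog : 0 ≤ Real.log n := Real.log_nonneg (by exact_mod_cast hn)
  have hl : 1 ≤ (Real.log n + 1) ^ 2 := one_le_pow₀ (by linarith)
  generalize (Real.log n + 1) ^ 2 = l at *
  generalize (n : ℝ) ^ (2 / 3 : ℝ) = x at *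
  generalize ((maxRandom a n + 2 : ℕ) : ℝ) ^ 2 = y at *
  have hxl : x ≤ x * l := le_mul_of_one_le_right (by linarith) hl
  have hDl : D ≤ D * l := le_mul_of_one_le_right hD hl
  have hrest : 0 ≤ 24 * 324 * ((a : ℝ) + 5) ^ 2 * D * l :=
    mul_nonneg (mul_nonneg (by positivity) hD) (by linarith)
  have h5 : T ≤ 200 * (x * l) + 200 * (D * l) + 24 * (324 * (a + 5) ^ 2 * x * l) := by
    linarith
  linarith

/-- A number of bits in which the values fit. -/
def slack (a : ℕ) : ℕ := 13 * (a + 7) ^ 2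

/-- The length is at most a constant times `(2 ^ bits n) ^ 2`, and `2 ^ (slack a * bits n)`
dominates that constant. -/
theorem phaseLength_lt (a : ℕ) (hn : 1 ≤ n) {K : ℕ} (hK : K ≤ 2 * n) :
    Program.phaseLength (window n) (maxRandom a n + 2) K + 1 < 2 ^ ((slack a + 2) * bits n) := by
  set z := 2 ^ bits n with hz
  have hnz : n < z := lt_two_pow_bits n
  have hwz : bits n < z := Nat.lt_two_pow_self
  have hk : maxRandom a n + 2 ≤ (a + 7) * z := by
    have h1 : n / 2 ^ coins a n ≤ n := Nat.div_le_self _ _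
    have h2 : a * bits n ≤ a * z := Nat.mul_le_mul_left a hwz.le
    have h3 : 1 ≤ z := by omega
    rw [maxRandom]
    nlinarith
  have hk2 : (maxRandom a n + 2) ^ 2 ≤ (a + 7) ^ 2 * z ^ 2 := by
    rw [← mul_pow]
    exact Nat.pow_le_pow_left hk 2
  have hwin := window_le hn
  have hzz : z ≤ z ^ 2 := Nat.le_self_pow two_ne_zero z
  have h7 : 7 ^ 2 ≤ (a + 7) ^ 2 := Nat.pow_le_pow_left (by omega) 2
  have hlen : Program.phaseLength (window n) (maxRandom a n + 2) K + 1 ≤ slack a * z ^ 2 := by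
    rw [Program.phaseLength, slack]
    nlinarith
  have hslack : slack a < 2 ^ (slack a * bits n) :=
    Nat.lt_two_pow_self.trans_le (Nat.pow_le_pow_right (by norm_num)
      (Nat.le_mul_of_pos_right _ (bits_pos n)))
  calc _ ≤ slack a * z ^ 2 := hlen
    _ < 2 ^ (slack a * bits n) * z ^ 2 :=
        Nat.mul_lt_mul_of_pos_right hslack (by positivity)
    _ = _ := by rw [hz, ← pow_mul, ← pow_add]; congr 1; ring

end Parameters

open Parameters in
theorem mainTheorem7 (a c : ℕ) :
    ∃ (β k : ℕ) (C : ℝ) (R : ℕ → ℕ)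
      (A : (n : ℕ) → CongestAlgorithm (β * (Nat.log 2 n + 1)) (R n) ℕ∞),
      ∀ (n : ℕ) (I : RPathsInstance n),
        (∀ v, I.ident v < 2 ^ (c * (Nat.log 2 n + 1))) →
        ∃ T : ℕ,
          (T : ℝ) ≤ C * ((n : ℝ) ^ (2 / 3 : ℝ) + I.network.diam) * (Real.log n + 1) ^ k ∧
          (∀ ω, (A n).HaltsWithin I ω T) ∧
          1 - 1 / (n : ℝ) ^ a ≤ coinProb (fun ω => LongDetourCorrect (A n) I ω T) := by
  classical
  let e := slack a
  let S : ℕ → ℕ := fun n => 2 ^ ((c + 5) * bits n)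
  refine ⟨8 * (c + 5) + e + 2, 2, 200 + 24 * 324 * (a + 5) ^ 2, coins a, fun n =>
    Program.algorithm _ (S n ^ 8) (coins a n) fun inp bit =>
      Program.complete n (S n ^ 8) (window n) (maxRandom a n + 2) inp (∀ i, bit i = true),
    fun n I hid => ?_⟩
  let P : LocalInput → (Fin (coins a n) → Bool) → Program := fun inp bit =>
    Program.complete n (S n ^ 8) (window n) (maxRandom a n + 2) inp (∀ i, bit i = true)
  have hn : 1 ≤ n := by have := I.s.pos; omega
  have hG : I.network.Connected := I.connected
  have hdiam := hG.diam_lt_card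
  rw [Fintype.card_fin] at hdiam
  set B := (8 * (c + 5) + e + 2) * (Nat.log 2 n + 1) with hBdef
  -- A message splits into `8 * (c + 5)` blocks of bits for the item and `e + 2` blocks for the
  -- value.
  have hBS : 2 ^ B = 2 ^ ((e + 2) * bits n) * S n ^ 8 := by
    rw [← pow_mul, ← pow_add, hBdef, bits]
    congr 1
    ring
  have hwpos := bits_pos n
  have hS0 : 0 < S n := by positivity
  have hlen : ∀ K ≤ 2 * n,
      (Program.phaseLength (window n) (maxRandom a n + 2) K + 1) * S n ^ 8 < 2 ^ B := fun K hK => by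
    rw [hBS]
    exact Nat.mul_lt_mul_of_pos_right (phaseLength_lt a hn hK) (by positivity)
  have hsuit : ∀ K, (∀ u v, I.network.dist u v ≤ 2 * K) → K ≤ 2 * I.network.diam + 1 →
      I.Suitable B (S n) (window n) K (maxRandom a n + 2) := by
    intro K hdist hK
    have h8 : 4 * 2 ^ bits n ≤ S n := by
      have : 4 * 2 ^ bits n = 2 ^ (2 + bits n) := by rw [pow_add]; norm_num
      rw [this]
      exact Nat.pow_le_pow_right (by norm_num) (by nlinarith)
    have hnw := lt_two_pow_bits n
    have hwin := window_le hn
    refine ⟨fun v => (hid v).trans_le (Nat.pow_le_pow_right (by norm_num)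
      (Nat.mul_le_mul_right _ (by omega))), by omega, by omega, hdist, (hlen K (by omega)).le⟩
  have hprobe : (4 * n + 3) * S n ^ 8 < 2 ^ B := by
    refine lt_of_le_of_lt (Nat.mul_le_mul_right _ ?_) (hlen (2 * n) le_rfl)
    rw [Program.phaseLength]
    have := window_pos hn
    omega
  obtain ⟨T, hT, hexec⟩ := RPathsInstance.exec_complete (I := I) hS0 hprobe hsuit
  choose o ho hcorrect using hexec
  have hout : ∀ ω v, (Program.algorithm B (S n ^ 8) (coins a n) P).output
      ((Program.algorithm B (S n ^ 8) (coins a n) P).run I ω T v) =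
      some (o (fun v => ∀ i, ω v i = true) v) := fun ω v =>
    Program.Exec.output_run I B (S n ^ 8) (P := P) (ho fun v => ∀ i, ω v i = true) v
  change ∃ T : ℕ, _ ∧ (∀ ω, (Program.algorithm B (S n ^ 8) (coins a n) P).HaltsWithin I ω T) ∧
    _ ≤ coinProb fun ω => LongDetourCorrect (Program.algorithm B (S n ^ 8) (coins a n) P) I ω T
  clear_value P
  refine ⟨T, ?_, fun ω v => ?_, ?_⟩
  · have h1 : (T : ℝ) ≤ 12 * (2 * I.network.diam + 1) + 8 * (4 * window n +
        2 * (2 * I.network.diam + 1) + 3 * ((maxRandom a n + 2 : ℕ) : ℝ) ^ 2 + 1 + 1) := by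
      rw [Program.phaseLength] at hT
      exact_mod_cast hT
    exact rounds_le a hn (Nat.cast_nonneg _) h1
  · rw [hout]
    rfl
  · refine (good_likely a I).trans (coinProb_mono fun ω hL i hi => ?_)
    exact ⟨_, hout _ _, hcorrect _ hL i hi⟩
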